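/- Let $M$ be a complex manifold of complex dimension $3$, and let $g$ be a holomorphic Riemannian metric on $M$, i.e. a holomorphic field of non-degenerate symmetric complex bilinear forms $g_x$ on the holomorphic tangent spaces $T_xM$. Assume that $g$ is locally homogeneous: for all $m,n\in M$ there is a biholomorphism $\varphi$ from an open neighbourhood of $m$ onto an open neighbourhood of $n$ with $\varphi(m)=n$ and $\varphi^*g=g$. For $x_0\in M$ let $\mathcal G$ be the Killing algebra of $g$ at $x_0$, that is, the complex Lie algebra of germs at $x_0$ of holomorphic vector fields $X$ with $L_Xg=0$. Then, for every $x_0\in M$, $$\dim_{\mathbb C}\mathcal G\neq 5 .$$ -/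

import Mathlib

open scoped Manifold ContDiff Topology Bundle

noncomputable section

namespace HolRiem

variable {E : Type*} [NormedAddCommGroup E] [NormedSpace ℂ E]
  (M : Type*) [TopologicalSpace M] [ChartedSpace E M] [IsManifold 𝓘(ℂ, E) ω M]

/-- A holomorphic Riemannian metric on a complex manifold `M`: a holomorphic field of
nondegenerate symmetric complex bilinear forms on the holomorphic tangent spaces. -/
structure Metric where
  /-- the bilinear form on the tangent space at `x` -/
  form : ∀ x : M, TangentSpace 𝓘(ℂ, E) x →L[ℂ] TangentSpace 𝓘(ℂ, E) x →L[ℂ] ℂ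
  symm : ∀ (x : M) (v w : TangentSpace 𝓘(ℂ, E) x), form x v w = form x w v
  nondegenerate : ∀ (x : M) (v : TangentSpace 𝓘(ℂ, E) x), (∀ w, form x v w = 0) → v = 0
  holomorphic : ContMDiff 𝓘(ℂ, E) (𝓘(ℂ, E).prod 𝓘(ℂ, E →L[ℂ] E →L[ℂ] ℂ)) ω
    (fun x : M ↦ Bundle.TotalSpace.mk' (E →L[ℂ] E →L[ℂ] ℂ)
      (E := fun x : M ↦ TangentSpace 𝓘(ℂ, E) x →L[ℂ] TangentSpace 𝓘(ℂ, E) x →L[ℂ] ℂ) x (form x))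

variable {M}

/-- The vector field `X` is holomorphic on a neighbourhood of `x`. -/
def HolomorphicAt (X : ∀ x : M, TangentSpace 𝓘(ℂ, E) x) (x : M) : Prop :=
  ContMDiffAt 𝓘(ℂ, E) 𝓘(ℂ, E).tangent ω
    (fun y : M ↦ (Bundle.TotalSpace.mk' E y (X y) : TangentBundle 𝓘(ℂ, E) M)) x

namespace Metric

variable (g : Metric (E := E) M)

/-- `φ` is a local isometry of `g`: a biholomorphism between open subsets of `M` that
pulls `g` back to itself. -/
structure IsLocalIsometry (φ : OpenPartialHomeomorph M M) : Prop where
  holomorphic : ContMDiffOn 𝓘(ℂ, E) 𝓘(ℂ, E) ω φ φ.source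
  holomorphic_symm : ContMDiffOn 𝓘(ℂ, E) 𝓘(ℂ, E) ω φ.symm φ.target
  isometry : ∀ x ∈ φ.source, ∀ v w : TangentSpace 𝓘(ℂ, E) x,
    g.form (φ x) (mfderiv 𝓘(ℂ, E) 𝓘(ℂ, E) φ x v) (mfderiv 𝓘(ℂ, E) 𝓘(ℂ, E) φ x w) = g.form x v w

/-- `g` is locally homogeneous: any two points are exchanged by a local isometry. -/
def LocallyHomogeneous : Prop :=
  ∀ m n : M, ∃ φ : OpenPartialHomeomorph M M, g.IsLocalIsometry φ ∧ m ∈ φ.source ∧ φ m = n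

/-- The Lie derivative of `g` evaluated on vector fields `Y`, `Z` at the point `x`:
`(L_X g)(Y, Z) = X · g(Y, Z) - g([X, Y], Z) - g(Y, [X, Z])`. -/
def lieDeriv (X Y Z : ∀ x : M, TangentSpace 𝓘(ℂ, E) x) (x : M) : ℂ :=
  mvfderiv 𝓘(ℂ, E) (fun y ↦ g.form y (Y y) (Z y)) x (X x)
    - g.form x (VectorField.mlieBracket 𝓘(ℂ, E) X Y x) (Z x)
    - g.form x (Y x) (VectorField.mlieBracket 𝓘(ℂ, E) X Z x)

/-- `X` satisfies the Killing equation at `x`: it is holomorphic at `x` and `L_X g` vanishes at `x`. -/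
def KillingAt (X : ∀ x : M, TangentSpace 𝓘(ℂ, E) x) (x : M) : Prop :=
  HolomorphicAt X x ∧ ∀ Y Z : (∀ x : M, TangentSpace 𝓘(ℂ, E) x),
    HolomorphicAt Y x → HolomorphicAt Z x → g.lieDeriv X Y Z x = 0

end Metric

theorem HolomorphicAt.mdifferentiableAt {X : ∀ x : M, TangentSpace 𝓘(ℂ, E) x} {x : M}
    (h : HolomorphicAt X x) : MDifferentiableAt 𝓘(ℂ, E) 𝓘(ℂ, E).tangent
      (fun y : M ↦ (Bundle.TotalSpace.mk' E y (X y) : TangentBundle 𝓘(ℂ, E) M)) x :=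
  ContMDiffAt.mdifferentiableAt h (by simp)

theorem HolomorphicAt.zero (x : M) :
    HolomorphicAt (0 : ∀ x : M, TangentSpace 𝓘(ℂ, E) x) x :=
  haveI : IsManifold 𝓘(ℂ, E) (ω + 1) M := ‹IsManifold 𝓘(ℂ, E) ω M›
  (Bundle.contMDiff_zeroSection ℂ (TangentSpace 𝓘(ℂ, E) : M → Type _)).contMDiffAt

theorem HolomorphicAt.add {X X' : ∀ x : M, TangentSpace 𝓘(ℂ, E) x} {x : M}
    (h : HolomorphicAt X x) (h' : HolomorphicAt X' x) : HolomorphicAt (X + X') x :=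
  haveI : IsManifold 𝓘(ℂ, E) (ω + 1) M := ‹IsManifold 𝓘(ℂ, E) ω M›
  ContMDiffAt.add_section h h'

theorem HolomorphicAt.const_smul (c : ℂ) {X : ∀ x : M, TangentSpace 𝓘(ℂ, E) x} {x : M}
    (h : HolomorphicAt X x) : HolomorphicAt (c • X) x :=
  haveI : IsManifold 𝓘(ℂ, E) (ω + 1) M := ‹IsManifold 𝓘(ℂ, E) ω M›
  ContMDiffAt.const_smul_section h

namespace Metric

variable [FiniteDimensional ℂ E] (g : Metric (E := E) M)

theorem lieDeriv_add {X X' : ∀ x : M, TangentSpace 𝓘(ℂ, E) x} {x : M}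
    (h : HolomorphicAt X x) (h' : HolomorphicAt X' x) (Y Z : ∀ x : M, TangentSpace 𝓘(ℂ, E) x) :
    g.lieDeriv (X + X') Y Z x = g.lieDeriv X Y Z x + g.lieDeriv X' Y Z x := by
  have : CompleteSpace E := FiniteDimensional.complete ℂ E
  unfold lieDeriv
  rw [VectorField.mlieBracket_add_left h.mdifferentiableAt h'.mdifferentiableAt,
    VectorField.mlieBracket_add_left h.mdifferentiableAt h'.mdifferentiableAt]
  simp only [Pi.add_apply, map_add, add_apply]
  ring

theorem lieDeriv_const_smul (c : ℂ) {X : ∀ x : M, TangentSpace 𝓘(ℂ, E) x} {x : M}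
    (h : HolomorphicAt X x) (Y Z : ∀ x : M, TangentSpace 𝓘(ℂ, E) x) :
    g.lieDeriv (c • X) Y Z x = c * g.lieDeriv X Y Z x := by
  have : CompleteSpace E := FiniteDimensional.complete ℂ E
  unfold lieDeriv
  rw [VectorField.mlieBracket_const_smul_left h.mdifferentiableAt,
    VectorField.mlieBracket_const_smul_left h.mdifferentiableAt]
  simp only [Pi.smul_apply, map_smul, smul_apply, smul_eq_mul]
  ring

/-- The space of vector fields that are Killing on some neighbourhood of `x₀`. -/
def killingNear (x₀ : M) : Submodule ℂ (∀ x : M, TangentSpace 𝓘(ℂ, E) x) where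
  carrier := {X | ∀ᶠ x in 𝓝 x₀, g.KillingAt X x}
  zero_mem' := Filter.Eventually.of_forall fun x ↦ ⟨HolomorphicAt.zero x, fun Y Z _ _ ↦ by
    simp [lieDeriv]⟩
  add_mem' := by
    intro X X' hX hX'
    filter_upwards [hX, hX'] with x h h'
    refine ⟨h.1.add h'.1, fun Y Z hY hZ ↦ ?_⟩
    have e := h.2 Y Z hY hZ
    have e' := h'.2 Y Z hY hZ
    rw [lieDeriv_add g h.1 h'.1, e, e', add_zero]
  smul_mem' := by
    intro c X hX
    filter_upwards [hX] with x h
    refine ⟨h.1.const_smul c, fun Y Z hY hZ ↦ ?_⟩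
    rw [lieDeriv_const_smul g c h.1, h.2 Y Z hY hZ, mul_zero]

/-- The space of vector fields that vanish on some neighbourhood of `x₀`. -/
def _root_.HolRiem.vanishingNear (x₀ : M) : Submodule ℂ (∀ x : M, TangentSpace 𝓘(ℂ, E) x) where
  carrier := {X | ∀ᶠ x in 𝓝 x₀, X x = 0}
  zero_mem' := by simp
  add_mem' := by
    intro X Y hX hY
    filter_upwards [hX, hY] with x h1 h2
    simp [h1, h2]
  smul_mem' := by
    intro c X hX
    filter_upwards [hX] with x h1
    simp [h1]

/-- The Killing algebra of `g` at `x₀`: germs at `x₀` of holomorphic Killing fields. -/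
abbrev KillingAlgebra (x₀ : M) : Type _ :=
  g.killingNear x₀ ⧸ (vanishingNear x₀).comap (g.killingNear x₀).subtype

end Metric

end HolRiem

end

/-! In complex dimension three, an orthonormal coframe `σ` and the cross product identify both the
tangent space and `so(3)` with `ℂ³`. The torsion-free metric connection `θ` and its curvature then
take values in `ℂ³`, and the curvature is a symmetric operator `S` with `curv u v = S (σ u × σ v)`.
A Killing field has components `ξ` and a rotation vector `η`, and these satisfy a closed linear
system: `∇ξ = σ × η` and `∇η = S (ξ × σ)`. A Killing germ is therefore determined by the value of
`(ξ, η)` in `ℂ⁶` at the point (`IsKillingPair.eventually_eq_zero`).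

Suppose there are five independent germs. Their one-jets stay independent at nearby points, so at
each such point a two-dimensional space of them has `ξ = 0`. The integrability condition makes `S`
commute with two independent infinitesimal rotations, hence `S` is a scalar `k` (`curvOp_eq_smul`).
The same condition, applied to a field with `ξ ≠ 0`, gives `dk = 0` (`exists_curvOp_eq_const_smul`).

For scalar `S` the pairing `ξ · η' + η · ξ'` on `ℂ⁶` is invariant under the connection defined by
the system. Five independent parallel sections and a nondegenerate parallel form determine a sixth
parallel section by algebra: its products with the five and with itself must be constant. No
integration theorem is needed (`exists_parallel_completion`). The sixth section is a Killing germ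
outside the span of the five, so the dimension cannot be exactly five. -/

open scoped Manifold ContDiff Topology Bundle
open scoped Matrix

/-! ### Linear algebra of the cross product on `ℂ³` -/

namespace HolRiem

/-- The cross product of `ℂ³` as a continuous bilinear map. -/
noncomputable def crossL : (Fin 3 → ℂ) →L[ℂ] (Fin 3 → ℂ) →L[ℂ] (Fin 3 → ℂ) :=
  (crossProduct (R := ℂ)).toContinuousBilinearMap

@[simp] theorem crossL_apply (a b : Fin 3 → ℂ) : crossL a b = a ⨯₃ b := rfl

/-- The dot product of `ℂ³` as a continuous bilinear form. -/
noncomputable def dotL : (Fin 3 → ℂ) →L[ℂ] (Fin 3 → ℂ) →L[ℂ] ℂ :=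
  (dotProductBilin ℂ ℂ).toContinuousBilinearMap

@[simp] theorem dotL_apply (a b : Fin 3 → ℂ) : dotL a b = a ⬝ᵥ b := rfl

theorem eq_zero_of_forall_dot {a : Fin 3 → ℂ} (h : ∀ b : Fin 3 → ℂ, a ⬝ᵥ b = 0) : a = 0 := by
  ext i
  simpa using h (Pi.single i 1)

theorem eq_zero_of_forall_cross {a : Fin 3 → ℂ} (h : ∀ b : Fin 3 → ℂ, b ⨯₃ a = 0) : a = 0 := by
  have h0 := h ![1, 0, 0]
  have h1 := h ![0, 1, 0]
  simp [cross_apply] at h0 h1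
  ext i
  fin_cases i
  · exact h1.2
  · exact h0.2
  · exact h0.1

/-- A linear map on `ℂ³` in coordinates. -/
theorem linear_apply_three {F : Type*} [AddCommGroup F] [Module ℂ F]
    (f : (Fin 3 → ℂ) →ₗ[ℂ] F) (a : Fin 3 → ℂ) :
    f a = a 0 • f ![1, 0, 0] + a 1 • f ![0, 1, 0] + a 2 • f ![0, 0, 1] := by
  rw [← map_smul, ← map_smul, ← map_smul, ← map_add, ← map_add]
  congr 1
  ext i
  fin_cases i <;> simp

/-- An alternating bilinear map on `ℂ³` factors through the cross product. -/
theorem alternating_eq_cross (T : (Fin 3 → ℂ) →ₗ[ℂ] (Fin 3 → ℂ) →ₗ[ℂ] (Fin 3 → ℂ))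
    (hT : ∀ a, T a a = 0) (a b : Fin 3 → ℂ) :
    T a b = (a ⨯₃ b) 0 • T ![0, 1, 0] ![0, 0, 1] + (a ⨯₃ b) 1 • T ![0, 0, 1] ![1, 0, 0]
      + (a ⨯₃ b) 2 • T ![1, 0, 0] ![0, 1, 0] := by
  have hs : ∀ a b, T b a = - T a b := by
    intro a b
    have := hT (a + b)
    simp only [map_add, LinearMap.add_apply, hT, zero_add, add_zero] at this
    exact eq_neg_of_add_eq_zero_left this
  rw [linear_apply_three (T a) b]
  have e : ∀ c, T a c = a 0 • T ![1, 0, 0] c + a 1 • T ![0, 1, 0] c + a 2 • T ![0, 0, 1] c :=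
    fun c => linear_apply_three (T.flip c) a
  rw [e, e, e, hT, hT, hT, hs ![1, 0, 0] ![0, 1, 0], hs ![0, 1, 0] ![0, 0, 1],
    hs ![0, 0, 1] ![1, 0, 0]]
  ext i
  simp [cross_apply]
  ring

/-- A skew endomorphism of `ℂ³` is the cross product with a vector. -/
theorem skew_eq_cross (K : (Fin 3 → ℂ) →ₗ[ℂ] (Fin 3 → ℂ))
    (hK : ∀ a b, K a ⬝ᵥ b + a ⬝ᵥ K b = 0) (a : Fin 3 → ℂ) :
    K a = a ⨯₃ ![K ![0, 0, 1] 1, K ![1, 0, 0] 2, K ![0, 1, 0] 0] := by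
  have h00 := hK ![1, 0, 0] ![1, 0, 0]
  have h11 := hK ![0, 1, 0] ![0, 1, 0]
  have h22 := hK ![0, 0, 1] ![0, 0, 1]
  have h01 := hK ![1, 0, 0] ![0, 1, 0]
  have h02 := hK ![1, 0, 0] ![0, 0, 1]
  have h12 := hK ![0, 1, 0] ![0, 0, 1]
  simp [dotProduct, Fin.sum_univ_three] at h00 h11 h22 h01 h02 h12
  rw [linear_apply_three K a]
  ext i
  fin_cases i <;> simp [cross_apply]
  · linear_combination a 0 * h00 + a 2 * h02
  · linear_combination a 1 * h11 + a 0 * h01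
  · linear_combination a 2 * h22 + a 1 * h12

/-- A linear endomorphism of `ℂ³` satisfying the cyclic identity is symmetric; the cyclic identity
on the standard basis is enough. -/
theorem symmetric_of_cyclic (S : (Fin 3 → ℂ) →ₗ[ℂ] (Fin 3 → ℂ))
    (h : S ![1, 0, 0] ⨯₃ ![1, 0, 0] + S ![0, 1, 0] ⨯₃ ![0, 1, 0]
      + S ![0, 0, 1] ⨯₃ ![0, 0, 1] = 0) (a b : Fin 3 → ℂ) : S a ⬝ᵥ b = a ⬝ᵥ S b := by
  -- The components of the cyclic sum are the differences of opposite off-diagonal entries of `S`.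
  have h0 := congrFun h 0
  have h1 := congrFun h 1
  have h2 := congrFun h 2
  simp [cross_apply] at h0 h1 h2
  rw [linear_apply_three S a, linear_apply_three S b]
  simp [dotProduct, Fin.sum_univ_three]
  linear_combination (a 2 * b 1 - a 1 * b 2) * h0 + (a 0 * b 2 - a 2 * b 0) * h1
    + (a 1 * b 0 - a 0 * b 1) * h2

/-- The unique solution `N` of the equation `b × N a - a × N b = S (a × b) × ξ`
for a symmetric `S`. -/
theorem eq_of_cross_sub_cross (S N : (Fin 3 → ℂ) →ₗ[ℂ] (Fin 3 → ℂ)) (ξ : Fin 3 → ℂ)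
    (hS : ∀ a b, S a ⬝ᵥ b = a ⬝ᵥ S b)
    (hN : ∀ a b, b ⨯₃ N a - a ⨯₃ N b = S (a ⨯₃ b) ⨯₃ ξ) (a : Fin 3 → ℂ) : N a = S (ξ ⨯₃ a) := by
  have s01 := hS ![1, 0, 0] ![0, 1, 0]
  have s02 := hS ![1, 0, 0] ![0, 0, 1]
  have s12 := hS ![0, 1, 0] ![0, 0, 1]
  simp [dotProduct, Fin.sum_univ_three] at s01 s02 s12
  have key : ∀ a b, b ⨯₃ S (ξ ⨯₃ a) - a ⨯₃ S (ξ ⨯₃ b) = S (a ⨯₃ b) ⨯₃ ξ := by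
    intro a b
    rw [linear_apply_three S (ξ ⨯₃ a), linear_apply_three S (ξ ⨯₃ b), linear_apply_three S (a ⨯₃ b)]
    ext i
    fin_cases i <;> simp [cross_apply, s01, s02, s12] <;> ring
  -- The difference `M` of two solutions satisfies `M a × b + a × M b = 0`. The left side is `(tr M
  -- - Mᵀ) (a × b)`, so `Mᵀ = tr M`; taking traces gives `M = 0`. The halves in the coefficients
  -- below come from this trace.
  obtain ⟨M, hM⟩ : ∃ M : (Fin 3 → ℂ) →ₗ[ℂ] (Fin 3 → ℂ), ∀ a, M a = N a - S (ξ ⨯₃ a) :=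
    ⟨N - S ∘ₗ crossProduct ξ, fun a => rfl⟩
  have hM' : ∀ a b, b ⨯₃ M a = a ⨯₃ M b := by
    intro a b
    rw [hM, hM, map_sub, map_sub]
    have := hN a b
    rw [← key a b] at this
    linear_combination (exp := 1) this
  have m01 := hM' ![1, 0, 0] ![0, 1, 0]
  have m02 := hM' ![1, 0, 0] ![0, 0, 1]
  have m12 := hM' ![0, 1, 0] ![0, 0, 1]
  have p := fun i => congrFun m01 i
  have q := fun i => congrFun m02 i
  have r := fun i => congrFun m12 i
  have p0 := p 0; have p1 := p 1; have p2 := p 2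
  have q0 := q 0; have q1 := q 1; have q2 := q 2
  have r0 := r 0; have r1 := r 1; have r2 := r 2
  simp [cross_apply] at p0 p1 p2 q0 q1 q2 r0 r1 r2
  have : M a = 0 := by
    rw [linear_apply_three M a]
    ext i
    fin_cases i <;> simp
    · linear_combination a 0 / 2 * (q1 + r0 - p2) + a 1 * r1 + a 2 * r2
    · linear_combination a 0 * q0 + a 1 / 2 * (-p2 - r0 - q1) - a 2 * q2
    · linear_combination a 0 * p0 + a 1 * p1 + a 2 / 2 * (q1 - r0 + p2)
  rw [hM] at this
  exact sub_eq_zero.1 this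

theorem exists_dot_eq_one {b : Fin 3 → ℂ} (hb : b ≠ 0) : ∃ d : Fin 3 → ℂ, d ⬝ᵥ b = 1 := by
  obtain ⟨i, hi⟩ := Function.ne_iff.1 hb
  exact ⟨Pi.single i (b i)⁻¹, by simpa using inv_mul_cancel₀ hi⟩

/-- Expand `d × (a × b)`. The auxiliary `d` replaces division by `b · b`, which may vanish for `b ≠
0`. -/
theorem eq_smul_of_cross_eq_zero {a b d : Fin 3 → ℂ} (hd : d ⬝ᵥ b = 1) (h : a ⨯₃ b = 0) :
    a = (d ⬝ᵥ a) • b := by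
  have e := cross_cross_eq_smul_sub_smul' d a b
  rw [h, map_zero, hd, one_smul] at e
  rw [dotProduct_comm d a]
  exact (sub_eq_zero.1 e.symm)

/-- A symmetric endomorphism of `ℂ³` commuting with two linearly independent infinitesimal
rotations is a scalar. -/
theorem scalar_of_commute_cross (S : (Fin 3 → ℂ) →ₗ[ℂ] (Fin 3 → ℂ))
    (hS : ∀ a b, S a ⬝ᵥ b = a ⬝ᵥ S b) (p q : Fin 3 → ℂ) (hpq : p ⨯₃ q ≠ 0)
    (hp : ∀ c, S (c ⨯₃ p) = S c ⨯₃ p) (hq : ∀ c, S (c ⨯₃ q) = S c ⨯₃ q) :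
    ∃ k : ℂ, ∀ a, S a = k • a := by
  have hp0 : p ≠ 0 := by rintro rfl; simp at hpq
  have hq0 : q ≠ 0 := by rintro rfl; simp at hpq
  -- `S p × p = S (p × p) = 0`, so `p` is an eigenvector; likewise `q`.
  obtain ⟨k, hk⟩ : ∃ k : ℂ, S p = k • p := by
    obtain ⟨d, hd⟩ := exists_dot_eq_one hp0
    exact ⟨_, eq_smul_of_cross_eq_zero hd (by rw [← hp, cross_self, map_zero])⟩
  obtain ⟨l, hl⟩ : ∃ k : ℂ, S q = k • q := by
    obtain ⟨d, hd⟩ := exists_dot_eq_one hq0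
    exact ⟨_, eq_smul_of_cross_eq_zero hd (by rw [← hq, cross_self, map_zero])⟩
  obtain ⟨n, hn⟩ : ∃ n, n = p ⨯₃ q := ⟨_, rfl⟩
  rw [← hn] at hpq
  -- `S (p × q)` equals both `k (p × q)` and `l (p × q)`.
  have hkl : k = l := by
    have e1 := hq p
    have e2 := hp q
    rw [hk, ← hn, map_smul, LinearMap.smul_apply, ← hn] at e1
    rw [hl, ← cross_anticomm, ← hn, map_neg, map_smul, LinearMap.smul_apply, ← cross_anticomm p q,
      ← hn, smul_neg, neg_inj, e1] at e2
    exact smul_left_injective ℂ hpq e2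
  subst hkl
  obtain ⟨d, hd⟩ := exists_dot_eq_one hpq
  obtain ⟨T, hT⟩ : ∃ T : (Fin 3 → ℂ) →ₗ[ℂ] (Fin 3 → ℂ), ∀ a, T a = S a - k • a :=
    ⟨S - k • LinearMap.id, fun a => rfl⟩
  have Tsymm : ∀ a b, T a ⬝ᵥ b = a ⬝ᵥ T b := by
    intro a b
    simp [hT, hS]
  have Tp : ∀ c, T (c ⨯₃ p) = T c ⨯₃ p := by intro c; simp [hT, hp]
  have Tq : ∀ c, T (c ⨯₃ q) = T c ⨯₃ q := by intro c; simp [hT, hq]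
  -- `T` is symmetric and kills `p` and `q`, so its image is orthogonal to both and lies on the line
  -- of `n = p × q`. By symmetry `T c = μ (n · c) n`. Since `n` may be isotropic, `p, q, n` need not
  -- be a basis, and `μ = 0` needs a separate argument.
  have T1 : ∀ c, T c = (d ⬝ᵥ T c) • n := by
    intro c
    refine eq_smul_of_cross_eq_zero hd ?_
    have h1 : T c ⬝ᵥ p = 0 := by rw [Tsymm, hT, hk, sub_self, dotProduct_zero]
    have h2 : T c ⬝ᵥ q = 0 := by rw [Tsymm, hT, hl, sub_self, dotProduct_zero]
    rw [hn, cross_cross_eq_smul_sub_smul', h2, dotProduct_comm, h1]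
    simp
  obtain ⟨μ, hμ⟩ : ∃ μ, μ = d ⬝ᵥ T d := ⟨_, rfl⟩
  have T2 : ∀ c, T c = (μ * (n ⬝ᵥ c)) • n := by
    intro c
    rw [T1 c, ← Tsymm, T1 d, smul_dotProduct, ← hμ, smul_eq_mul]
  have hdn : n ⬝ᵥ d = 1 := by rw [dotProduct_comm, hd]
  have main : μ = 0 := by
    by_contra hμ0
    -- Commutation at `d` gives `n × w = r n` with `r = n · (d × w) = -d · (n × w) = -r`, so `r =
    -- 0`. For `w = p, q` this makes `p` and `q` both parallel to `n`.
    have step : ∀ w, (∀ c, T (c ⨯₃ w) = T c ⨯₃ w) → n ⨯₃ w = 0 := by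
      intro w hw
      have e := hw d
      rw [T2, T2, hdn, mul_one, map_smul, LinearMap.smul_apply, mul_smul] at e
      have e1 : n ⨯₃ w = (n ⬝ᵥ d ⨯₃ w) • n := (smul_right_injective _ hμ0 e).symm
      have e2 : n ⬝ᵥ d ⨯₃ w = - (d ⬝ᵥ n ⨯₃ w) := by
        rw [triple_product_permutation, ← cross_anticomm, dotProduct_neg]
      have e3 : n ⬝ᵥ d ⨯₃ w = 0 := by
        rw [e1, dotProduct_smul, hd] at e2
        simp only [smul_eq_mul, mul_one] at e2
        linear_combination e2 / 2
      rw [e1, e3, zero_smul]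
    have np := step p Tp
    have nq := step q Tq
    have ep : p = (d ⬝ᵥ p) • n :=
      eq_smul_of_cross_eq_zero hd (by rw [← cross_anticomm, np, neg_zero])
    rw [ep, map_smul, LinearMap.smul_apply, nq, smul_zero] at hn
    exact hpq hn
  refine ⟨k, fun a => ?_⟩
  have := T2 a
  rw [main, zero_mul, zero_smul, hT] at this
  exact sub_eq_zero.1 this

/-- If `f u (ξ × v)` is symmetric in `u`, `v` for a linear form `f` and `ξ ≠ 0`, then `f = 0`. -/
theorem linearForm_eq_zero (f : (Fin 3 → ℂ) →ₗ[ℂ] ℂ) (ξ : Fin 3 → ℂ) (hξ : ξ ≠ 0)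
    (h : ∀ a b, f a • (ξ ⨯₃ b) = f b • (ξ ⨯₃ a)) : f = 0 := by
  by_contra hf
  obtain ⟨a, ha⟩ : ∃ a, f a = 1 := by
    obtain ⟨c, hc⟩ := not_forall.1 (fun h0 => hf (LinearMap.ext h0))
    exact ⟨(f c)⁻¹ • c, by simpa using inv_mul_cancel₀ hc⟩
  obtain ⟨d, hd⟩ := exists_dot_eq_one hξ
  have e : ∀ b, ξ ⨯₃ (b - f b • a) = 0 := by
    intro b
    rw [map_sub, map_smul, ← h a b, ha, one_smul, sub_self]
  have e' : ∀ b, b = (d ⬝ᵥ (b - f b • a)) • ξ + f b • a := by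
    intro b
    rw [← eq_smul_of_cross_eq_zero hd (by rw [← cross_anticomm, e, neg_zero]), sub_add_cancel]
  have fin : ∀ b, f b = 0 → ∃ r : ℂ, b = r • ξ := by
    intro b hb
    refine ⟨_, by simpa [hb] using e' b⟩
  -- The kernel of a nonzero form on `ℂ³` is a plane, yet here it would lie on the line of `ξ`.
  have c := Submodule.finrank_mono (s := LinearMap.ker f) (t := Submodule.span ℂ {ξ}) (by
    intro b hb
    obtain ⟨r, hr⟩ := fin b hb
    exact hr ▸ Submodule.smul_mem _ _ (Submodule.mem_span_singleton_self ξ))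
  rw [finrank_span_singleton hξ] at c
  have r := LinearMap.finrank_range_add_finrank_ker f
  have r' := Submodule.finrank_le (LinearMap.range f)
  simp at r r'
  omega

end HolRiem

/-! ### Connections with values in `ℂ³`: Ricci and Bianchi identities -/

namespace HolRiem

variable {E : Type*} [NormedAddCommGroup E] [NormedSpace ℂ E]

/-- The covariant derivative of `f : E → ℂ³` for the `so(3)`-connection `θ`. -/
noncomputable def covD (θ : E → E →L[ℂ] (Fin 3 → ℂ)) (f : E → Fin 3 → ℂ) (y : E) :
    E →L[ℂ] (Fin 3 → ℂ) :=
  fderiv ℂ f y + (crossL.flip (f y)) ∘L θ y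

theorem covD_apply (θ : E → E →L[ℂ] (Fin 3 → ℂ)) (f : E → Fin 3 → ℂ) (y v : E) :
    covD θ f y v = fderiv ℂ f y v + θ y v ⨯₃ f y := rfl

/-- The curvature of the `so(3)`-connection `θ`. -/
noncomputable def curv (θ : E → E →L[ℂ] (Fin 3 → ℂ)) (y u v : E) : Fin 3 → ℂ :=
  fderiv ℂ θ y u v - fderiv ℂ θ y v u + θ y u ⨯₃ θ y v

/-- The torsion of the coframe `σ` for the `so(3)`-connection `θ`. -/
noncomputable def torsion (σ θ : E → E →L[ℂ] (Fin 3 → ℂ)) (y u v : E) : Fin 3 → ℂ :=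
  fderiv ℂ σ y u v - fderiv ℂ σ y v u + θ y u ⨯₃ σ y v - θ y v ⨯₃ σ y u

/-- The Ricci identity. -/
theorem curv_cross {θ h : E → E →L[ℂ] (Fin 3 → ℂ)} {f : E → Fin 3 → ℂ} {y : E}
    (hθ : DifferentiableAt ℂ θ y) (hf : ContDiffAt ℂ ω f y) (hh : DifferentiableAt ℂ h y)
    (heq : ∀ᶠ z in 𝓝 y, covD θ f z = h z) (u v : E) :
    curv θ y u v ⨯₃ f y = (fderiv ℂ h y u v + θ y u ⨯₃ h y v)
      - (fderiv ℂ h y v u + θ y v ⨯₃ h y u) := by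
  have hfd : DifferentiableAt ℂ f y := hf.differentiableAt (by simp)
  have hy := heq.self_of_nhds
  have e : fderiv ℂ f =ᶠ[𝓝 y] fun z => h z - (crossL.flip (f z)) ∘L θ z := by
    filter_upwards [heq] with z hz
    rw [← hz, covD, add_sub_cancel_right]
  have d : HasFDerivAt (fun z => (crossL.flip (f z)) ∘L θ z) _ y :=
    ((crossL.flip).hasFDerivAt.comp y hfd.hasFDerivAt).clm_comp hθ.hasFDerivAt
  have D : ∀ a b, fderiv ℂ (fderiv ℂ f) y a b
      = fderiv ℂ h y a b - (fderiv ℂ θ y a b ⨯₃ f y + θ y b ⨯₃ fderiv ℂ f y a) := by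
    intro a b
    rw [e.fderiv_eq, (hh.hasFDerivAt.fun_sub d).fderiv]
    simp [add_comm]
  -- The second derivative of `f`, computed from `∇f = h`, is symmetric; the Jacobi identity turns
  -- the iterated `θ`-terms into the quadratic part of the curvature.
  have sy := (hf.isSymmSndFDerivAt (by simp)).eq u v
  have du : ∀ a, fderiv ℂ f y a = h y a - θ y a ⨯₃ f y := by
    intro a
    rw [← hy, covD_apply, add_sub_cancel_right]
  rw [D, D, du, du] at sy
  have jac := cross_cross (θ y u) (θ y v) (f y)
  simp only [curv, map_add, map_sub, LinearMap.add_apply, LinearMap.sub_apply, jac] at sy ⊢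
  linear_combination (exp := 1) -sy

/-- The first Bianchi identity of a torsion-free connection. -/
theorem bianchi {σ θ : E → E →L[ℂ] (Fin 3 → ℂ)} {y : E} (hσ : ContDiffAt ℂ ω σ y)
    (hθ : DifferentiableAt ℂ θ y) (hT : ∀ᶠ z in 𝓝 y, ∀ u v, torsion σ θ z u v = 0) (u v w : E) :
    curv θ y u v ⨯₃ σ y w + curv θ y v w ⨯₃ σ y u + curv θ y w u ⨯₃ σ y v = 0 := by
  have hσd : DifferentiableAt ℂ σ y := hσ.differentiableAt (by simp)
  have hσ' : DifferentiableAt ℂ (fderiv ℂ σ) y :=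
    (hσ.fderiv_right (m := ω) (by simp)).differentiableAt (by simp)
  have sy := fun a b => (hσ.isSymmSndFDerivAt (by simp)).eq a b
  have hy := hT.self_of_nhds
  -- Derivative of the vanishing torsion. In the cyclic sum the second derivatives of `σ` cancel by
  -- symmetry, and the first derivatives are removed by the torsion identity crossed with `θ`.
  have key : ∀ a b c, fderiv ℂ (fderiv ℂ σ) y a b c - fderiv ℂ (fderiv ℂ σ) y a c b
      + (fderiv ℂ θ y a b ⨯₃ σ y c + θ y b ⨯₃ fderiv ℂ σ y a c)
      - (fderiv ℂ θ y a c ⨯₃ σ y b + θ y c ⨯₃ fderiv ℂ σ y a b) = 0 := by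
    intro a b c
    have ev : ∀ {τ : E → E →L[ℂ] (Fin 3 → ℂ)}, DifferentiableAt ℂ τ y → ∀ b,
        HasFDerivAt (fun z => τ z b) ((fderiv ℂ τ y).flip b) y := fun h b => by
      simpa using h.hasFDerivAt.clm_apply (hasFDerivAt_const b y)
    have ev2 : ∀ b c, HasFDerivAt (fun z => fderiv ℂ σ z b c)
        (((fderiv ℂ (fderiv ℂ σ) y).flip b).flip c) y := fun b c => by
      have h1 : HasFDerivAt (fun z => fderiv ℂ σ z b) ((fderiv ℂ (fderiv ℂ σ) y).flip b) y := by
        simpa using hσ'.hasFDerivAt.clm_apply (hasFDerivAt_const b y)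
      simpa using h1.clm_apply (hasFDerivAt_const c y)
    have h := (((ev2 b c).sub (ev2 c b)).add
      (crossL.hasFDerivAt_of_bilinear (ev hθ b) (ev hσd c))).sub
      (crossL.hasFDerivAt_of_bilinear (ev hθ c) (ev hσd b))
    have h0 := h.congr_of_eventuallyEq (f₁ := fun _ => (0 : Fin 3 → ℂ)) (by
      filter_upwards [hT] with z hz
      exact (hz b c).symm)
    have := congrArg (fun L => L a) (h0.unique (hasFDerivAt_const _ _))
    simpa [add_comm, add_left_comm] using this
  have k1 := key u v w
  have k2 := key v w u
  have k3 := key w u v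
  rw [sy v w, sy v u] at k2
  rw [sy w u] at k3
  have t1 := congrArg (fun x => θ y w ⨯₃ x) (hy u v)
  have t2 := congrArg (fun x => θ y u ⨯₃ x) (hy v w)
  have t3 := congrArg (fun x => θ y v ⨯₃ x) (hy w u)
  simp only [torsion, map_add, map_sub, map_zero] at t1 t2 t3
  simp only [curv, map_add, map_sub, LinearMap.add_apply, LinearMap.sub_apply, cross_cross]
  linear_combination (exp := 1) k1 + k2 + k3 + t1 + t2 + t3

end HolRiem

/-! ### Coframes, the curvature operator and the prolonged Killing system -/

namespace HolRiem

variable {E : Type*} [NormedAddCommGroup E] [NormedSpace ℂ E]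

/-- `σ` is near `y` a holomorphic coframe and `θ` a torsion-free connection for it. -/
structure IsCoframeAt (σ θ : E → E →L[ℂ] (Fin 3 → ℂ)) (y : E) : Prop where
  coframe : ContDiffAt ℂ ω σ y
  connection : ContDiffAt ℂ ω θ y
  invertible : (σ y).IsInvertible
  torsion_eq_zero : ∀ᶠ z in 𝓝 y, ∀ u v, torsion σ θ z u v = 0

/-- The pair `(ξ, η)` consists near `y` of the coframe components of a Killing field
and its rotation vector. -/
structure IsKillingPair (σ θ : E → E →L[ℂ] (Fin 3 → ℂ)) (ξ η : E → Fin 3 → ℂ) (y : E) : Prop where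
  field : ContDiffAt ℂ ω ξ y
  rotation : ContDiffAt ℂ ω η y
  covD_field : ∀ᶠ z in 𝓝 y, ∀ v, covD θ ξ z v = σ z v ⨯₃ η z

omit [NormedSpace ℂ E] in
theorem eventually_isInvertible {F G : Type*} [NormedAddCommGroup F]
    [NormedSpace ℂ F] [NormedAddCommGroup G] [NormedSpace ℂ G] [CompleteSpace F]
    {f : E → F →L[ℂ] G} {y : E} (hf : ContinuousAt f y) (h : (f y).IsInvertible) :
    ∀ᶠ z in 𝓝 y, (f z).IsInvertible := by
  obtain ⟨e, he⟩ := h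
  exact hf (he ▸ ContinuousLinearEquiv.nhds e)

theorem IsCoframeAt.eventually [CompleteSpace E] {σ θ : E → E →L[ℂ] (Fin 3 → ℂ)} {y : E}
    (h : IsCoframeAt σ θ y) : ∀ᶠ z in 𝓝 y, IsCoframeAt σ θ z := by
  filter_upwards [h.coframe.eventually (by simp), h.connection.eventually (by simp),
    eventually_isInvertible h.coframe.continuousAt h.invertible,
    h.torsion_eq_zero.eventually_nhds] with z h1 h2 h3 h4
  exact ⟨h1, h2, h3, h4⟩

theorem IsKillingPair.eventually {σ θ : E → E →L[ℂ] (Fin 3 → ℂ)} {ξ η : E → Fin 3 → ℂ} {y : E}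
    (h : IsKillingPair σ θ ξ η y) : ∀ᶠ z in 𝓝 y, IsKillingPair σ θ ξ η z := by
  filter_upwards [h.field.eventually (by simp), h.rotation.eventually (by simp),
    h.covD_field.eventually_nhds] with z h1 h2 h3
  exact ⟨h1, h2, h3⟩

theorem IsKillingPair.sum_smul {ι : Type*} [Fintype ι] {σ θ : E → E →L[ℂ] (Fin 3 → ℂ)}
    {ξ η : ι → E → Fin 3 → ℂ} {y : E} (h : ∀ i, IsKillingPair σ θ (ξ i) (η i) y) (c : ι → ℂ) :
    IsKillingPair σ θ (fun z => ∑ i, c i • ξ i z) (fun z => ∑ i, c i • η i z) y := by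
  refine ⟨ContDiffAt.sum fun i _ => (h i).field.const_smul (c i),
    ContDiffAt.sum fun i _ => (h i).rotation.const_smul (c i), ?_⟩
  have h1 := Filter.eventually_all.2 fun i => (h i).covD_field
  have h2 := Filter.eventually_all.2 fun i => (h i).eventually
  filter_upwards [h1, h2] with z hz hz' v
  have d : ∀ i ∈ Finset.univ, HasFDerivAt (fun z => c i • ξ i z) (c i • fderiv ℂ (ξ i) z) z :=
    fun i _ => (((hz' i).field.differentiableAt (by simp)).hasFDerivAt).const_smul (c i)
  rw [covD_apply, (HasFDerivAt.fun_sum d).fderiv]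
  simp only [sum_apply, smul_apply, map_sum, map_smul,
    ← hz, covD_apply, Finset.sum_add_distrib, smul_add]

/-- The curvature operator: `curv u v = curvOp (σ u × σ v)`. -/
noncomputable def curvOp (σ θ : E → E →L[ℂ] (Fin 3 → ℂ)) (y : E) :
    (Fin 3 → ℂ) →L[ℂ] (Fin 3 → ℂ) :=
  (ContinuousLinearMap.proj (R := ℂ) (φ := fun _ : Fin 3 => ℂ) 0).smulRight
      (curv θ y ((σ y).inverse ![0, 1, 0]) ((σ y).inverse ![0, 0, 1]))
    + (ContinuousLinearMap.proj (R := ℂ) (φ := fun _ : Fin 3 => ℂ) 1).smulRight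
      (curv θ y ((σ y).inverse ![0, 0, 1]) ((σ y).inverse ![1, 0, 0]))
    + (ContinuousLinearMap.proj (R := ℂ) (φ := fun _ : Fin 3 => ℂ) 2).smulRight
      (curv θ y ((σ y).inverse ![1, 0, 0]) ((σ y).inverse ![0, 1, 0]))

theorem curv_self (θ : E → E →L[ℂ] (Fin 3 → ℂ)) (y u : E) : curv θ y u u = 0 := by
  simp [curv, cross_self]

theorem contDiffAt_inverse [CompleteSpace E] {F G : Type*} [NormedAddCommGroup F]
    [NormedSpace ℂ F] [NormedAddCommGroup G] [NormedSpace ℂ G] [CompleteSpace F]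
    {f : E → F →L[ℂ] G} {y : E} (h : ContDiffAt ℂ ω f y) (h' : (f y).IsInvertible) :
    ContDiffAt ℂ ω (fun z => (f z).inverse) y := by
  obtain ⟨e, he⟩ := h'
  exact (he ▸ contDiffAt_map_inverse e : ContDiffAt ℂ ω _ (f y)).comp y h

/-- In dimension three a two-form factors through the cross product. -/
theorem curv_eq_curvOp {σ θ : E → E →L[ℂ] (Fin 3 → ℂ)} {y : E} (h : (σ y).IsInvertible)
    (u v : E) : curv θ y u v = curvOp σ θ y (σ y u ⨯₃ σ y v) := by
  let T : (Fin 3 → ℂ) →ₗ[ℂ] (Fin 3 → ℂ) →ₗ[ℂ] (Fin 3 → ℂ) :=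
    LinearMap.mk₂ ℂ (fun a b => curv θ y ((σ y).inverse a) ((σ y).inverse b))
      (fun a b c => by simp [curv]; abel) (fun r a b => by simp [curv, smul_sub])
      (fun a b c => by simp [curv]; abel) (fun r a b => by simp [curv, smul_sub])
  have := alternating_eq_cross T (fun a => curv_self _ _ _) (σ y u) (σ y v)
  simp only [T, LinearMap.mk₂_apply, h.inverse_apply_self] at this
  rw [this]
  simp [curvOp]

theorem IsCoframeAt.contDiffAt_curvOp [CompleteSpace E] {σ θ : E → E →L[ℂ] (Fin 3 → ℂ)} {y : E}
    (h : IsCoframeAt σ θ y) : ContDiffAt ℂ ω (curvOp σ θ) y := by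
  have hi := contDiffAt_inverse h.coframe h.invertible
  have hθ' : ContDiffAt ℂ ω (fderiv ℂ θ) y := h.connection.fderiv_right (m := ω) (by simp)
  have hc : ∀ a b, ContDiffAt ℂ ω
      (fun z => curv θ z ((σ z).inverse a) ((σ z).inverse b)) y := by
    intro a b
    have ha := hi.clm_apply (contDiffAt_const (c := a))
    have hb := hi.clm_apply (contDiffAt_const (c := b))
    have hx : ContDiffAt ℂ ω (fun z => crossL (θ z ((σ z).inverse a)) (θ z ((σ z).inverse b))) y :=
      (crossL.contDiff.contDiffAt.comp y (h.connection.clm_apply ha)).clm_apply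
        (h.connection.clm_apply hb)
    exact (((hθ'.clm_apply ha).clm_apply hb).sub ((hθ'.clm_apply hb).clm_apply ha)).add hx
  have hs : ∀ (L : (Fin 3 → ℂ) →L[ℂ] ℂ) {f : E → Fin 3 → ℂ}, ContDiffAt ℂ ω f y →
      ContDiffAt ℂ ω (fun z => L.smulRight (f z)) y := fun L f hf =>
    (ContinuousLinearMap.smulRightL ℂ (Fin 3 → ℂ) (Fin 3 → ℂ) L).contDiff.contDiffAt.comp y hf
  exact ((hs _ (hc _ _)).add (hs _ (hc _ _))).add (hs _ (hc _ _))

/-- The first Bianchi identity on the dual frame is the cyclic condition for `curvOp`. -/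
theorem IsCoframeAt.curvOp_symm {σ θ : E → E →L[ℂ] (Fin 3 → ℂ)} {y : E}
    (h : IsCoframeAt σ θ y) (a b : Fin 3 → ℂ) :
    curvOp σ θ y a ⬝ᵥ b = a ⬝ᵥ curvOp σ θ y b := by
  refine symmetric_of_cyclic (curvOp σ θ y : (Fin 3 → ℂ) →ₗ[ℂ] (Fin 3 → ℂ)) ?_ a b
  have := bianchi h.coframe (h.connection.differentiableAt (by simp)) h.torsion_eq_zero
    ((σ y).inverse ![0, 1, 0]) ((σ y).inverse ![0, 0, 1]) ((σ y).inverse ![1, 0, 0])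
  simp only [curv_eq_curvOp h.invertible, h.invertible.self_apply_inverse] at this
  simpa [cross_apply] using this

/-- The rotation vector of a Killing field satisfies a first-order equation. -/
theorem IsKillingPair.covD_rotation {σ θ : E → E →L[ℂ] (Fin 3 → ℂ)} {ξ η : E → Fin 3 → ℂ} {y : E}
    (h : IsCoframeAt σ θ y) (hk : IsKillingPair σ θ ξ η y) (v : E) :
    covD θ η y v = curvOp σ θ y (ξ y ⨯₃ σ y v) := by
  have hσd : DifferentiableAt ℂ σ y := h.coframe.differentiableAt (by simp)
  have hηd : DifferentiableAt ℂ η y := hk.rotation.differentiableAt (by simp)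
  have d : HasFDerivAt (fun z => (crossL.flip (η z)) ∘L σ z) _ y :=
    ((crossL.flip).hasFDerivAt.comp y hηd.hasFDerivAt).clm_comp hσd.hasFDerivAt
  -- Ricci identity for `∇ξ = σ × η`, with the derivatives of `σ` removed by vanishing torsion. It
  -- determines `∇η` uniquely by `eq_of_cross_sub_cross`.
  have key : ∀ u v, curvOp σ θ y (σ y u ⨯₃ σ y v) ⨯₃ ξ y
      = σ y v ⨯₃ covD θ η y u - σ y u ⨯₃ covD θ η y v := by
    intro u v
    have := curv_cross (h.connection.differentiableAt (by simp)) hk.field d.differentiableAt (by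
      filter_upwards [hk.covD_field] with z hz
      ext1 v
      simpa using hz v) u v
    rw [d.fderiv, curv_eq_curvOp h.invertible] at this
    have t := congrArg (fun x => x ⨯₃ η y) (h.torsion_eq_zero.self_of_nhds u v)
    simp [torsion, covD_apply, cross_cross] at this t ⊢
    linear_combination (exp := 1) this + t
  have := eq_of_cross_sub_cross (curvOp σ θ y : (Fin 3 → ℂ) →ₗ[ℂ] (Fin 3 → ℂ))
    ((covD θ η y ∘L (σ y).inverse : (Fin 3 → ℂ) →L[ℂ] (Fin 3 → ℂ)) :
      (Fin 3 → ℂ) →ₗ[ℂ] (Fin 3 → ℂ)) (ξ y) h.curvOp_symm (by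
      intro a b
      have := key ((σ y).inverse a) ((σ y).inverse b)
      simp only [h.invertible.self_apply_inverse] at this
      exact this.symm) (σ y v)
  simpa [h.invertible.inverse_apply_self] using this

/-- The integrability condition of the equation satisfied by the rotation vector. -/
theorem IsKillingPair.integrability {σ θ : E → E →L[ℂ] (Fin 3 → ℂ)} {ξ η : E → Fin 3 → ℂ} {y : E}
    (h : IsCoframeAt σ θ y) (hk : IsKillingPair σ θ ξ η y)
    {S : E → (Fin 3 → ℂ) →L[ℂ] (Fin 3 → ℂ)} (hS : DifferentiableAt ℂ S y)
    (hη : ∀ᶠ z in 𝓝 y, ∀ v, covD θ η z v = S z (ξ z ⨯₃ σ z v)) (u v : E) :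
    curv θ y u v ⨯₃ η y - S y ((σ y u ⨯₃ σ y v) ⨯₃ η y)
      = (fderiv ℂ S y u (ξ y ⨯₃ σ y v) + θ y u ⨯₃ S y (ξ y ⨯₃ σ y v)
          - S y (θ y u ⨯₃ (ξ y ⨯₃ σ y v)))
        - (fderiv ℂ S y v (ξ y ⨯₃ σ y u) + θ y v ⨯₃ S y (ξ y ⨯₃ σ y u)
          - S y (θ y v ⨯₃ (ξ y ⨯₃ σ y u))) := by
  have hσd : DifferentiableAt ℂ σ y := h.coframe.differentiableAt (by simp)
  have hξd : DifferentiableAt ℂ ξ y := hk.field.differentiableAt (by simp)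
  have d : HasFDerivAt (fun z => S z ∘L (crossL (ξ z) ∘L σ z)) _ y :=
    hS.hasFDerivAt.clm_comp ((crossL.hasFDerivAt.comp y hξd.hasFDerivAt).clm_comp hσd.hasFDerivAt)
  -- Ricci identity for `∇η = S (ξ × σ)`. The operator `S` is left free: it will be `curvOp` in one
  -- use and a scalar function in the other.
  have := curv_cross (h.connection.differentiableAt (by simp)) hk.rotation d.differentiableAt (by
    filter_upwards [hη] with z hz
    ext1 v
    simpa using hz v) u v
  have hd : ∀ a b, fderiv ℂ (fun z => S z ∘L (crossL (ξ z) ∘L σ z)) y a b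
      = S y (ξ y ⨯₃ fderiv ℂ σ y a b + fderiv ℂ ξ y a ⨯₃ σ y b)
        + fderiv ℂ S y a (ξ y ⨯₃ σ y b) := fun a b => by
    rw [d.fderiv]
    rfl
  rw [hd, hd] at this
  have t := congrArg (fun x => S y (ξ y ⨯₃ x)) (h.torsion_eq_zero.self_of_nhds u v)
  have e : ∀ v, fderiv ℂ ξ y v = σ y v ⨯₃ η y - θ y v ⨯₃ ξ y := fun v => by
    rw [← hk.covD_field.self_of_nhds, covD_apply, add_sub_cancel_right]
  have j : (σ y u ⨯₃ σ y v) ⨯₃ η y = (σ y u ⨯₃ η y) ⨯₃ σ y v - (σ y v ⨯₃ η y) ⨯₃ σ y u := by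
    ext i
    fin_cases i <;> simp [cross_apply] <;> ring
  rw [this, j]
  simp only [torsion, e, leibniz_cross (θ y _) (ξ y), map_add, map_sub, LinearMap.sub_apply, map_zero,
    ContinuousLinearMap.comp_apply, crossL_apply] at t ⊢
  linear_combination (exp := 1) t

end HolRiem

/-! ### Rigidity of Killing germs and constancy of the curvature -/

namespace HolRiem

variable {E : Type*} [NormedAddCommGroup E] [NormedSpace ℂ E]

/-- A function whose derivative is bounded by a multiple of the function itself vanishes near
each of its zeros. -/
theorem eventually_eq_zero_of_norm_fderiv_le {V : Type*} [NormedAddCommGroup V] [NormedSpace ℂ V]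
    {F : E → V} {y : E} {C : ℝ} (hF : ∀ᶠ z in 𝓝 y, DifferentiableAt ℂ F z)
    (hb : ∀ᶠ z in 𝓝 y, ∀ v, ‖fderiv ℂ F z v‖ ≤ C * ‖F z‖ * ‖v‖) (h0 : F y = 0) :
    ∀ᶠ z in 𝓝 y, F z = 0 := by
  obtain ⟨r, hr, hball⟩ := Metric.eventually_nhds_iff_ball.1 (hF.and hb)
  filter_upwards [Metric.ball_mem_nhds y hr] with z hz
  have hmem : ∀ t ∈ Set.Icc (0 : ℝ) 1, y + (t : ℂ) • (z - y) ∈ Metric.ball y r := by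
    intro t ht
    rw [mem_ball_iff_norm, add_sub_cancel_left, norm_smul, Complex.norm_real,
      Real.norm_of_nonneg ht.1]
    rw [mem_ball_iff_norm] at hz
    exact (mul_le_of_le_one_left (norm_nonneg _) ht.2).trans_lt hz
  have hd : ∀ t ∈ Set.Icc (0 : ℝ) 1, HasDerivAt (fun s : ℝ => F (y + (s : ℂ) • (z - y)))
      (fderiv ℂ F (y + (t : ℂ) • (z - y)) (z - y)) t := by
    intro t ht
    have h1 : HasDerivAt (fun s : ℝ => y + (s : ℂ) • (z - y)) (z - y) t := by
      simpa using ((hasDerivAt_id t).ofReal_comp.smul_const (z - y)).const_add y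
    have h2 : HasFDerivAt F (fderiv ℂ F (y + (t : ℂ) • (z - y))) (y + (t : ℂ) • (z - y)) :=
      (hball _ (hmem t ht)).1.hasFDerivAt
    exact (h2.restrictScalars ℝ).comp_hasDerivAt t h1
  -- Grönwall along the real segment from `y` to `z`.
  have := eq_zero_of_abs_deriv_le_mul_abs_self_of_eq_zero_right
    (f := fun s : ℝ => F (y + (s : ℂ) • (z - y))) (K := C * ‖z - y‖) (a := 0) (b := 1)
    (fun t ht => (hd t ht).continuousAt.continuousWithinAt)
    (fun t ht => (hd t ⟨ht.1, ht.2.le⟩).hasDerivWithinAt) (by simpa using h0)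
    (fun t ht => by
      have := (hball _ (hmem t ⟨ht.1, ht.2.le⟩)).2 (z - y)
      linarith) 1 (by simp)
  simpa using this

/-- A Killing field is determined near a point by its value and its rotation at the point. -/
theorem IsKillingPair.eventually_eq_zero [CompleteSpace E] {σ θ : E → E →L[ℂ] (Fin 3 → ℂ)}
    {ξ η : E → Fin 3 → ℂ} {y : E} (h : IsCoframeAt σ θ y) (hk : IsKillingPair σ θ ξ η y)
    (hξ : ξ y = 0) (hη : η y = 0) : ∀ᶠ z in 𝓝 y, ξ z = 0 ∧ η z = 0 := by
  have hbd : ∀ {f : E → ℝ}, ContinuousAt f y → ∀ᶠ z in 𝓝 y, f z ≤ f y + 1 := fun hf => by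
    filter_upwards [hf.eventually (gt_mem_nhds (lt_add_one _))] with z hz using hz.le
  obtain ⟨m, hm⟩ : ∃ m, m = max (‖σ y‖ + 1) (max (‖θ y‖ + 1) (‖curvOp σ θ y‖ + 1)) := ⟨_, rfl⟩
  have hm0 : 0 ≤ m := hm ▸ le_max_of_le_left (by positivity)
  have hσ := hbd h.coframe.continuousAt.norm
  have hθ := hbd h.connection.continuousAt.norm
  have hS := hbd h.contDiffAt_curvOp.continuousAt.norm
  obtain ⟨c, hc, cr⟩ := crossL.isBoundedBilinearMap.bound
  simp only [crossL_apply] at cr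
  -- With `c` bounding the cross product and `m` bounding `σ`, `θ`, `curvOp` near `y`, the
  -- derivatives of `ξ` and `η` have bounds `2cm` and `cm² + cm`; `C` dominates both.
  have := eventually_eq_zero_of_norm_fderiv_le (F := fun z => (ξ z, η z)) (y := y)
    (C := c * m * m + 2 * (c * m)) (by
      filter_upwards [hk.eventually] with z hz
      exact (hz.field.differentiableAt (by simp)).prodMk (hz.rotation.differentiableAt (by simp)))
    (by
      filter_upwards [hk.eventually, h.eventually, hσ, hθ, hS] with z hz hz' h1 h2 h3 v
      replace h1 : ‖σ z‖ ≤ m := h1.trans (by simp [hm])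
      replace h2 : ‖θ z‖ ≤ m := h2.trans (by simp [hm])
      replace h3 : ‖curvOp σ θ z‖ ≤ m := h3.trans (by simp [hm])
      have e1 : fderiv ℂ ξ z v = σ z v ⨯₃ η z - θ z v ⨯₃ ξ z := by
        rw [← hz.covD_field.self_of_nhds, covD_apply, add_sub_cancel_right]
      have e2 : fderiv ℂ η z v = curvOp σ θ z (ξ z ⨯₃ σ z v) - θ z v ⨯₃ η z := by
        rw [← hz.covD_rotation hz', covD_apply, add_sub_cancel_right]
      rw [((hz.field.differentiableAt (by simp)).hasFDerivAt.prodMk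
        (hz.rotation.differentiableAt (by simp)).hasFDerivAt).fderiv]
      have n1 : ‖ξ z‖ ≤ ‖(ξ z, η z)‖ := le_max_left _ _
      have n2 : ‖η z‖ ≤ ‖(ξ z, η z)‖ := le_max_right _ _
      have s1 : ‖σ z v‖ ≤ m * ‖v‖ := (σ z).le_of_opNorm_le h1 v
      have t1 : ‖θ z v‖ ≤ m * ‖v‖ := (θ z).le_of_opNorm_le h2 v
      rw [ContinuousLinearMap.prod_apply, e1, e2]
      refine max_le ?_ ?_
      · calc ‖σ z v ⨯₃ η z - θ z v ⨯₃ ξ z‖ ≤ ‖σ z v ⨯₃ η z‖ + ‖θ z v ⨯₃ ξ z‖ := norm_sub_le _ _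
          _ ≤ c * (m * ‖v‖) * ‖(ξ z, η z)‖ + c * (m * ‖v‖) * ‖(ξ z, η z)‖ := by
            refine add_le_add ((cr _ _).trans ?_) ((cr _ _).trans ?_) <;> gcongr
          _ ≤ c * m * m * ‖(ξ z, η z)‖ * ‖v‖ + (c * (m * ‖v‖) * ‖(ξ z, η z)‖
              + c * (m * ‖v‖) * ‖(ξ z, η z)‖) := le_add_of_nonneg_left (by positivity)
          _ = _ := by ring
      · calc ‖curvOp σ θ z (ξ z ⨯₃ σ z v) - θ z v ⨯₃ η z‖
            ≤ ‖curvOp σ θ z (ξ z ⨯₃ σ z v)‖ + ‖θ z v ⨯₃ η z‖ := norm_sub_le _ _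
          _ ≤ m * (c * ‖(ξ z, η z)‖ * (m * ‖v‖)) + c * (m * ‖v‖) * ‖(ξ z, η z)‖ := by
            refine add_le_add (((curvOp σ θ z).le_of_opNorm_le h3 _).trans ?_) ((cr _ _).trans ?_)
            · gcongr
              exact (cr _ _).trans (by gcongr)
            · gcongr
          _ ≤ m * (c * ‖(ξ z, η z)‖ * (m * ‖v‖)) + c * (m * ‖v‖) * ‖(ξ z, η z)‖
              + c * (m * ‖v‖) * ‖(ξ z, η z)‖ := le_add_of_nonneg_right (by positivity)
          _ = _ := by ring)
    (by simp [hξ, hη])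
  filter_upwards [this] with z hz using Prod.mk_eq_zero.1 hz

/-- If the isotropy at `y` is at least two-dimensional, the curvature operator is a scalar. -/
theorem curvOp_eq_smul [CompleteSpace E] {σ θ : E → E →L[ℂ] (Fin 3 → ℂ)} {y : E}
    (h : IsCoframeAt σ θ y) {ξ η : Fin 5 → E → Fin 3 → ℂ}
    (hk : ∀ i, IsKillingPair σ θ (ξ i) (η i) y)
    (hli : LinearIndependent ℂ fun i => (ξ i y, η i y)) :
    ∃ k : ℂ, ∀ a, curvOp σ θ y a = k • a := by
  -- For a combination with `ξ y = 0` the right side of the integrability condition vanishes,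
  -- leaving commutation with the rotation.
  have hcomm : ∀ c : Fin 5 → ℂ, ∑ i, c i • ξ i y = 0 → ∀ a,
      curvOp σ θ y (a ⨯₃ ∑ i, c i • η i y) = curvOp σ θ y a ⨯₃ ∑ i, c i • η i y := by
    intro c hc
    have hp := IsKillingPair.sum_smul hk c
    have hev : ∀ᶠ z in 𝓝 y, ∀ v, covD θ (fun z => ∑ i, c i • η i z) z v
        = curvOp σ θ z ((∑ i, c i • ξ i z) ⨯₃ σ z v) := by
      filter_upwards [hp.eventually, h.eventually] with z h1 h2 v
      exact h1.covD_rotation h2 v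
    have hint := hp.integrability h (h.contDiffAt_curvOp.differentiableAt (by simp)) hev
    simp only [hc, map_zero, LinearMap.zero_apply, sub_self, add_zero] at hint
    have hab : ∀ a b : Fin 3 → ℂ, curvOp σ θ y ((a ⨯₃ b) ⨯₃ ∑ i, c i • η i y)
        = curvOp σ θ y (a ⨯₃ b) ⨯₃ ∑ i, c i • η i y := by
      intro a b
      have := hint ((σ y).inverse a) ((σ y).inverse b)
      rw [curv_eq_curvOp h.invertible] at this
      simp only [h.invertible.self_apply_inverse] at this
      exact (sub_eq_zero.1 this).symm
    intro a
    have e0 : (![1, 0, 0] : Fin 3 → ℂ) = ![0, 1, 0] ⨯₃ ![0, 0, 1] := by simp [cross_apply]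
    have e1 : (![0, 1, 0] : Fin 3 → ℂ) = ![0, 0, 1] ⨯₃ ![1, 0, 0] := by simp [cross_apply]
    have e2 : (![0, 0, 1] : Fin 3 → ℂ) = ![1, 0, 0] ⨯₃ ![0, 1, 0] := by simp [cross_apply]
    have h0 := hab ![0, 1, 0] ![0, 0, 1]
    have h1 := hab ![0, 0, 1] ![1, 0, 0]
    have h2 := hab ![1, 0, 0] ![0, 1, 0]
    rw [← e0] at h0
    rw [← e1] at h1
    rw [← e2] at h2
    have ha := linear_apply_three (LinearMap.id : (Fin 3 → ℂ) →ₗ[ℂ] (Fin 3 → ℂ)) a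
    simp only [LinearMap.id_apply] at ha
    rw [ha]
    simp only [map_add, map_smul, LinearMap.add_apply, LinearMap.smul_apply, h0, h1, h2]
  let X : (Fin 5 → ℂ) →ₗ[ℂ] (Fin 3 → ℂ) := Fintype.linearCombination ℂ fun i => ξ i y
  have hX : ∀ c, X c = ∑ i, c i • ξ i y := fun c => Fintype.linearCombination_apply ℂ _ c
  -- Evaluation of `ξ` maps `ℂ⁵` to `ℂ³`, so the isotropy is at least two-dimensional.
  have hker : 2 ≤ Module.finrank ℂ (LinearMap.ker X) := by
    have r := LinearMap.finrank_range_add_finrank_ker X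
    have r' := Submodule.finrank_le (LinearMap.range X)
    simp at r r'
    omega
  obtain ⟨b, hb⟩ := exists_linearIndependent_of_le_finrank hker
  have hz : ∀ j, ∑ i, (b j : Fin 5 → ℂ) i • ξ i y = 0 := fun j => by
    rw [← hX]
    exact (b j).2
  have hlin : LinearIndependent ℂ fun j => ∑ i, (b j : Fin 5 → ℂ) i • η i y := by
    have h1 : LinearIndependent ℂ (fun j => (b j : Fin 5 → ℂ)) :=
      hb.map' (Submodule.subtype _) (Submodule.ker_subtype _)
    have h2 := h1.map' (Fintype.linearCombination ℂ fun i => (ξ i y, η i y))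
      (LinearMap.ker_eq_bot.2 (hli.fintypeLinearCombination_injective))
    refine LinearIndependent.of_comp (LinearMap.inr ℂ (Fin 3 → ℂ) (Fin 3 → ℂ)) ?_
    have e : (LinearMap.inr ℂ (Fin 3 → ℂ) (Fin 3 → ℂ)) ∘ (fun j => ∑ i, (b j : Fin 5 → ℂ) i • η i y)
        = (Fintype.linearCombination ℂ fun i => (ξ i y, η i y)) ∘ fun j => (b j : Fin 5 → ℂ) := by
      funext j
      rw [Function.comp_apply, Function.comp_apply, Fintype.linearCombination_apply]
      refine Prod.ext ?_ ?_
      · simp [Prod.fst_sum, hz]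
      · simp [Prod.snd_sum]
    rw [e]
    exact h2
  refine scalar_of_commute_cross (curvOp σ θ y : (Fin 3 → ℂ) →ₗ[ℂ] (Fin 3 → ℂ)) h.curvOp_symm
    (∑ i, (b 0 : Fin 5 → ℂ) i • η i y) (∑ i, (b 1 : Fin 5 → ℂ) i • η i y) ?_
    (hcomm _ (hz 0)) (hcomm _ (hz 1))
  rw [crossProduct_ne_zero_iff_linearIndependent]
  convert! hlin using 1
  ext j : 1
  fin_cases j <;> rfl

/-- Five independent Killing fields force constant sectional curvature. -/
theorem exists_curvOp_eq_const_smul [CompleteSpace E] {σ θ : E → E →L[ℂ] (Fin 3 → ℂ)} {y : E}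
    (h : IsCoframeAt σ θ y) {ξ η : Fin 5 → E → Fin 3 → ℂ}
    (hk : ∀ i, IsKillingPair σ θ (ξ i) (η i) y)
    (hli : LinearIndependent ℂ fun i => (ξ i y, η i y)) :
    ∃ k : ℂ, ∀ᶠ z in 𝓝 y, ∀ a, curvOp σ θ z a = k • a := by
  have hlin : ∀ᶠ z in 𝓝 y, LinearIndependent ℂ fun i => (ξ i z, η i z) := by
    have hc : ContinuousAt (fun z => fun i => (ξ i z, η i z)) y :=
      continuousAt_pi.2 fun i => (hk i).field.continuousAt.prodMk (hk i).rotation.continuousAt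
    exact hc.eventually (isOpen_setOfPred_linearIndependent.eventually_mem hli)
  have hkev : ∀ᶠ z in 𝓝 y, ∀ i, IsKillingPair σ θ (ξ i) (η i) z :=
    Filter.eventually_all.2 fun i => (hk i).eventually
  -- Reading `k` off a matrix entry makes it holomorphic.
  obtain ⟨k, hkdef⟩ : ∃ k : E → ℂ, ∀ z, k z = curvOp σ θ z ![1, 0, 0] 0 := ⟨_, fun z => rfl⟩
  have hkd : ∀ᶠ z in 𝓝 y, ContDiffAt ℂ ω k z := by
    filter_upwards [h.eventually] with z hz
    have : ContDiffAt ℂ ω (fun w => curvOp σ θ w ![1, 0, 0]) z :=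
      hz.contDiffAt_curvOp.clm_apply contDiffAt_const
    have e : k = fun w => curvOp σ θ w ![1, 0, 0] 0 := funext hkdef
    rw [e]
    exact contDiffAt_pi.1 this 0
  have hscal : ∀ᶠ z in 𝓝 y, ∀ a, curvOp σ θ z a = k z • a := by
    filter_upwards [hlin, hkev, h.eventually] with z h1 h2 h3
    obtain ⟨l, hl⟩ := curvOp_eq_smul h3 h2 h1
    rw [hkdef, hl]
    simpa using hl
  have hfd : ∀ᶠ z in 𝓝 y, fderiv ℂ k z = 0 := by
    filter_upwards [hlin, hkev, h.eventually, hkd, hscal.eventually_nhds, h.eventually.eventually_nhds]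
      with z h1 h2 h3 h4 h5 h6
    -- Otherwise the five rotation vectors would be independent in `ℂ³`.
    obtain ⟨i, hi⟩ : ∃ i, ξ i z ≠ 0 := by
      by_contra! hcon
      have : LinearIndependent ℂ fun i => η i z := by
        refine LinearIndependent.of_comp (LinearMap.inr ℂ (Fin 3 → ℂ) (Fin 3 → ℂ)) ?_
        convert! h1 using 2 with i
        simp [hcon]
      have := this.fintype_card_le_finrank
      simp at this
    have hkz : DifferentiableAt ℂ k z := h4.differentiableAt (by simp)
    have hS : HasFDerivAt (fun w => k w • ContinuousLinearMap.id ℂ (Fin 3 → ℂ)) _ z :=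
      hkz.hasFDerivAt.smul_const _
    -- With `S = k · id` only the `dk` terms survive: `dk(u) (ξ × σ v) = dk(v) (ξ × σ u)`.
    have hint := (h2 i).integrability h3 hS.differentiableAt (by
      filter_upwards [h5, (h2 i).eventually, h6] with w h5 h2 h6 v
      rw [h2.covD_rotation h6, h5]
      rfl)
    have hc := h5.self_of_nhds
    have hf := linearForm_eq_zero
      ((fderiv ℂ k z ∘L (σ z).inverse : (Fin 3 → ℂ) →L[ℂ] ℂ) : (Fin 3 → ℂ) →ₗ[ℂ] ℂ) (ξ i z) hi (by
        intro a b
        have := hint ((σ z).inverse a) ((σ z).inverse b)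
        rw [curv_eq_curvOp h3.invertible, hS.fderiv, hc] at this
        simp only [h3.invertible.self_apply_inverse] at this
        simp at this
        simpa using (sub_eq_zero.1 this.symm))
    ext v
    have := LinearMap.congr_fun hf (σ z v)
    simpa [h3.invertible.inverse_apply_self] using this
  obtain ⟨r, hr, hball⟩ := Metric.eventually_nhds_iff_ball.1 (hfd.and hkd)
  refine ⟨k y, ?_⟩
  filter_upwards [hscal, Metric.ball_mem_nhds y hr] with z hz hzb
  have : k z = k y := by
    let : NormedSpace ℝ E := .restrictScalars ℝ ℂ E
    exact Metric.isOpen_ball.is_const_of_fderiv_eq_zero (𝕜 := ℂ) (convex_ball y r).isPreconnected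
      (fun w hw => ((hball w hw).2.differentiableAt (by simp)).differentiableWithinAt)
      (fun w hw => (hball w hw).1) hzb (Metric.mem_ball_self hr)
  rwa [this] at hz

end HolRiem

/-! ### Completing a system of parallel sections -/

namespace HolRiem

variable {E : Type*} [NormedAddCommGroup E] [NormedSpace ℂ E]

/-- A holomorphic function with value `1` at `y` has a holomorphic square root near `y`. -/
theorem exists_sqrt {f : E → ℂ} {y : E} (hf : ContDiffAt ℂ ω f y) (h1 : f y = 1) :
    ∃ s : E → ℂ, ContDiffAt ℂ ω s y ∧ s y = 1 ∧ ∀ᶠ z in 𝓝 y, s z * s z = f z := by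
  refine ⟨fun z => Complex.exp (Complex.log (f z) / 2), ?_, by simp [h1], ?_⟩
  · have hl : ContDiffAt ℂ ω Complex.log (f y) := Complex.contDiffAt_log (by simp [h1])
    exact ((hl.comp y hf).div_const 2).cexp
  · filter_upwards [hf.continuousAt.eventually_ne (h1 ▸ one_ne_zero)] with z hz
    rw [← Complex.exp_add, add_halves, Complex.exp_log hz]

theorem eq_zero_of_forall_bilin_eq_zero {V ι : Type*} [NormedAddCommGroup V] [NormedSpace ℂ V]
    [FiniteDimensional ℂ V] [Fintype ι] {B : V →L[ℂ] V →L[ℂ] ℂ}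
    (hB : ∀ a, (∀ b, B b a = 0) → a = 0) {f : ι → V} (hf : LinearIndependent ℂ f)
    (hc : Fintype.card ι = Module.finrank ℂ V) {a : V} (ha : ∀ i, B (f i) a = 0) : a = 0 := by
  refine hB a fun b => ?_
  have hs := hf.span_eq_top_of_card_eq_finrank' hc
  have : b ∈ Submodule.span ℂ (Set.range f) := hs ▸ Submodule.mem_top
  have hle : Submodule.span ℂ (Set.range f) ≤ LinearMap.ker ((B.flip a : V →L[ℂ] ℂ) : V →ₗ[ℂ] ℂ) := by
    rw [Submodule.span_le]
    rintro _ ⟨i, rfl⟩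
    exact ha i
  exact hle this

/-- If all but one of a full system of parallel sections of a bundle with a parallel
nondegenerate bilinear form are known, the system can be completed. -/
theorem exists_parallel_completion [CompleteSpace E] {V ι : Type*} [NormedAddCommGroup V]
    [NormedSpace ℂ V] [FiniteDimensional ℂ V] [Fintype ι] (B : V →L[ℂ] V →L[ℂ] ℂ)
    (hsymm : ∀ a b, B a b = B b a) (hB : ∀ a, (∀ b, B b a = 0) → a = 0)
    (hn : Fintype.card ι + 1 = Module.finrank ℂ V) {y : E} {A : E → E → V → V}
    (hA : ∀ᶠ z in 𝓝 y, ∀ v a b, B (A z v a) b + B a (A z v b) = 0) {F : ι → E → V}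
    (hF : ∀ i, ContDiffAt ℂ ω (F i) y)
    (hp : ∀ i, ∀ᶠ z in 𝓝 y, ∀ v, fderiv ℂ (F i) z v = A z v (F i z))
    (hli : LinearIndependent ℂ fun i => F i y) :
    ∃ Z : E → V, ContDiffAt ℂ ω Z y ∧ (∀ᶠ z in 𝓝 y, ∀ v, fderiv ℂ Z z v = A z v (Z z)) ∧
      Z y ∉ Submodule.span ℂ (Set.range fun i => F i y) := by
  classical
  have hcard : Fintype.card (Option ι) = Module.finrank ℂ V := by rw [Fintype.card_option, hn]
  obtain ⟨w, hw⟩ : ∃ w, w ∉ Submodule.span ℂ (Set.range fun i => F i y) := by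
    by_contra! hcon
    have h1 := finrank_range_le_card (R := ℂ) (fun i => F i y)
    rw [Set.finrank, Submodule.eq_top_iff'.2 hcon, finrank_top] at h1
    omega
  -- `L z` records the products with the `F i z` and with the fixed vector `w`; it is invertible
  -- near `y`. Thus `n` spans the orthogonal complement of the `F i`, and `Z0` has the required
  -- products with them.
  let L : E → V →L[ℂ] (Option ι → ℂ) := fun z =>
    ∑ i, (B (F i z)).smulRight (Pi.single (some i) 1) + (B w).smulRight (Pi.single none 1)
  have Lsome : ∀ z a i, L z a (some i) = B (F i z) a := by
    intro z a i
    simp [L, sum_apply, Finset.sum_apply, Pi.single_apply]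
  have Lnone : ∀ z a, L z a none = B w a := by
    intro z a
    simp [L, sum_apply, Finset.sum_apply]
  have Lsmooth : ContDiffAt ℂ ω L y := by
    refine (ContDiffAt.sum fun i _ => ?_).add contDiffAt_const
    exact ((ContinuousLinearMap.smulRightL ℂ V (Option ι → ℂ)).flip
      (Pi.single (some i) 1)).contDiff.contDiffAt.comp y (B.contDiff.contDiffAt.comp y (hF i))
  have hopt : ∀ {x : V} {f : ι → V}, LinearIndependent ℂ f →
      x ∉ Submodule.span ℂ (Set.range f) →
      LinearIndependent ℂ (fun o : Option ι => o.elim x f) := by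
    intro x f h1 h2
    have h := LinearIndependent.option h1 h2
    have e : (fun o : Option ι => o.casesOn' x f) = fun o => o.elim x f := by
      funext o
      cases o <;> rfl
    rwa [e] at h
  have Linj : Function.Injective (L y) := by
    refine (injective_iff_map_eq_zero (L y)).2 fun a ha => ?_
    refine eq_zero_of_forall_bilin_eq_zero hB (hopt hli hw) hcard fun o => ?_
    cases o with
    | none => exact (Lnone y a).symm.trans (by rw [ha]; rfl)
    | some i => exact (Lsome y a i).symm.trans (by rw [ha]; rfl)
  have Linv : (L y).IsInvertible :=
    ⟨(LinearEquiv.ofInjectiveOfFinrankEq (L y : V →ₗ[ℂ] (Option ι → ℂ)) Linj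
      (by rw [Module.finrank_fintype_fun_eq_card, hcard])).toContinuousLinearEquiv, by ext; rfl⟩
  have Linv' := eventually_isInvertible Lsmooth.continuousAt Linv
  have Lis := contDiffAt_inverse Lsmooth Linv
  let n : E → V := fun z => (L z).inverse (Pi.single none 1)
  let Z0 : E → V := fun z => (L z).inverse (L y w)
  have hns : ContDiffAt ℂ ω n y := Lis.clm_apply contDiffAt_const
  have hZ0s : ContDiffAt ℂ ω Z0 y := Lis.clm_apply contDiffAt_const
  have hZ0y : Z0 y = w := Linv.inverse_apply_self w
  have hnF : ∀ᶠ z in 𝓝 y, ∀ i, B (F i z) (n z) = 0 := by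
    filter_upwards [Linv'] with z hz i
    rw [← Lsome, hz.self_apply_inverse]
    simp
  have hnw : B w (n y) = 1 := by
    rw [← Lnone y, Linv.self_apply_inverse]
    simp
  have hZF : ∀ᶠ z in 𝓝 y, ∀ i, B (F i z) (Z0 z) = B (F i y) w := by
    filter_upwards [Linv'] with z hz i
    rw [← Lsome, hz.self_apply_inverse, Lsome]
  have hBs : ∀ {f g : E → V}, ContDiffAt ℂ ω f y → ContDiffAt ℂ ω g y →
      ContDiffAt ℂ ω (fun z => B (f z) (g z)) y := fun hf hg =>
    (B.contDiff.contDiffAt.comp y hf).clm_apply hg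
  obtain ⟨s, hs, hs1, hs2⟩ := exists_sqrt (y := y)
    (f := fun z => B (Z0 z) (n z) * B (Z0 z) (n z)
      - B (n z) (n z) * (B (Z0 z) (Z0 z) - B w w))
    (((hBs hZ0s hns).mul (hBs hZ0s hns)).sub
      ((hBs hns hns).mul ((hBs hZ0s hZ0s).sub contDiffAt_const))) (by simp [hZ0y, hnw])
  -- The condition `B (Z, Z) = B (w, w)` for `Z = Z0 + λ n` is a quadratic in `λ`. This form of the
  -- root avoids dividing by `B (n, n)`, which may vanish; its denominator is `2` at `y`.
  let lam : E → ℂ := fun z => -(B (Z0 z) (Z0 z) - B w w) / (B (Z0 z) (n z) + s z)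
  have hden : B (Z0 y) (n y) + s y ≠ 0 := by
    rw [hZ0y, hnw, hs1]
    norm_num
  have hlam : ContDiffAt ℂ ω lam y :=
    ((hBs hZ0s hZ0s).sub contDiffAt_const).neg.div ((hBs hZ0s hns).add hs) hden
  have hden' : ∀ᶠ z in 𝓝 y, B (Z0 z) (n z) + s z ≠ 0 :=
    ((hBs hZ0s hns).add hs).continuousAt.eventually_ne hden
  let Z : E → V := fun z => Z0 z + lam z • n z
  have hZs : ContDiffAt ℂ ω Z y := hZ0s.add (hlam.smul hns)
  have hZy : Z y = w := by simp [Z, lam, hZ0y]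
  have c1 : ∀ᶠ z in 𝓝 y, ∀ i, B (F i z) (Z z) = B (F i y) w := by
    filter_upwards [hnF, hZF] with z h1 h2 i
    simp [Z, h1, h2]
  have c2 : ∀ᶠ z in 𝓝 y, B (Z z) (Z z) = B w w := by
    filter_upwards [hs2, hden'] with z h1 h2
    simp only [Z, lam, map_add, map_smul, add_apply, smul_apply, smul_eq_mul, hsymm (n z) (Z0 z)]
    field_simp
    linear_combination (B (Z0 z) (Z0 z) - B w w) * h1
  refine ⟨Z, hZs, ?_, hZy ▸ hw⟩
  have hli' : ∀ᶠ z in 𝓝 y, LinearIndependent ℂ (fun o : Option ι => o.elim (Z z) fun i => F i z) := by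
    have hc : ContinuousAt (fun z => fun o : Option ι => o.elim (Z z) fun i => F i z) y := by
      refine continuousAt_pi.2 fun o => ?_
      cases o with
      | none => exact hZs.continuousAt
      | some i => exact (hF i).continuousAt
    refine hc.eventually (isOpen_setOfPred_linearIndependent.eventually_mem ?_)
    change LinearIndependent ℂ fun o : Option ι => o.elim (Z y) fun i => F i y
    rw [hZy]
    exact hopt hli hw
  have hFd : ∀ᶠ z in 𝓝 y, ∀ i, DifferentiableAt ℂ (F i) z := Filter.eventually_all.2 fun i => by
    filter_upwards [(hF i).eventually (by simp)] with z hz using hz.differentiableAt (by simp)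
  filter_upwards [hli', c1.eventually_nhds, c2.eventually_nhds, hZs.eventually (by simp), hFd, hA,
    Filter.eventually_all.2 hp] with z h1 h2 h3 h4 h5 h6 h7 v
  have hZd : DifferentiableAt ℂ Z z := h4.differentiableAt (by simp)
  -- Differentiating the constant products shows that `dZ - A Z` is orthogonal to `Z` and to every
  -- `F i`, which form a basis.
  rw [← sub_eq_zero]
  refine eq_zero_of_forall_bilin_eq_zero hB h1 hcard fun o => ?_
  cases o with
  | none =>
    have e := (B.hasFDerivAt_of_bilinear hZd.hasFDerivAt hZd.hasFDerivAt).congr_of_eventuallyEq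
      (f₁ := fun _ => B w w) (by filter_upwards [h3] with x hx using hx.symm)
    have e1 := congrArg (fun L => L v) (e.unique (hasFDerivAt_const _ _))
    have e2 := h6 v (Z z) (Z z)
    simp [hsymm (fderiv ℂ Z z v)] at e1
    rw [hsymm (A z v _)] at e2
    change B (Z z) _ = 0
    rw [map_sub]
    linear_combination e1 - e2 / 2
  | some i =>
    have e := (B.hasFDerivAt_of_bilinear (h5 i).hasFDerivAt hZd.hasFDerivAt).congr_of_eventuallyEq
      (f₁ := fun _ => B (F i y) w) (by filter_upwards [h2] with x hx using (hx i).symm)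
    have e1 := congrArg (fun L => L v) (e.unique (hasFDerivAt_const _ _))
    have e2 := h6 v (F i z) (Z z)
    simp [h7] at e1
    change B (F i z) _ = 0
    rw [map_sub]
    linear_combination e1 - e2

end HolRiem

/-! ### Orthonormal coframes and their torsion-free connection -/

namespace HolRiem

variable {E : Type*} [NormedAddCommGroup E] [NormedSpace ℂ E]

/-- A nondegenerate symmetric bilinear form on a complex space of dimension three is
a sum of three squares. -/
theorem exists_equiv_dot [FiniteDimensional ℂ E] (hE : Module.finrank ℂ E = 3)
    (b : E →L[ℂ] E →L[ℂ] ℂ) (hs : ∀ u v, b u v = b v u) (hn : ∀ u, (∀ v, b u v = 0) → u = 0) :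
    ∃ e : E ≃L[ℂ] (Fin 3 → ℂ), ∀ u v, b u v = e u ⬝ᵥ e v := by
  let B : LinearMap.BilinForm ℂ E := b.toLinearMap₁₂
  have hB : ∀ u v, B u v = b u v := fun u v => rfl
  have hassoc : QuadraticMap.associated (R := ℂ) B.toQuadraticMap = B :=
    QuadraticMap.associated_left_inverse ℂ (fun u v => by simp [hB, hs u v])
  have heq := QuadraticForm.equivalent_weightedSumSquares_of_isAlgClosed B.toQuadraticMap (by
    rw [hassoc]
    exact fun u hu => hn u hu)
  rw [hE] at heq
  obtain ⟨f⟩ := heq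
  refine ⟨f.toLinearEquiv.toContinuousLinearEquiv, fun u v => ?_⟩
  have hf : ∀ u, f u ⬝ᵥ f u = b u u := by
    intro u
    have := f.map_app u
    simp only [QuadraticMap.weightedSumSquares_apply, Pi.one_apply, one_smul] at this
    exact this
  change b u v = f u ⬝ᵥ f v
  have h1 := hf (u + v)
  have h2 := hf u
  have h3 := hf v
  have h4 : f (u + v) = f u + f v := map_add f.toLinearEquiv u v
  rw [h4] at h1
  simp only [add_dotProduct, dotProduct_add, map_add, add_apply] at h1
  rw [dotProduct_comm (f v) (f u), hs v u] at h1
  linear_combination (h2 + h3 - h1) / 2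

/-- A holomorphic metric in dimension three has an orthonormal coframe near each point. -/
theorem exists_coframe [FiniteDimensional ℂ E] (hE : Module.finrank ℂ E = 3)
    {G : E → E →L[ℂ] E →L[ℂ] ℂ} {y : E} (hG : ContDiffAt ℂ ω G y)
    (hs : ∀ᶠ z in 𝓝 y, ∀ u v, G z u v = G z v u) (hn : ∀ u, (∀ v, G y u v = 0) → u = 0) :
    ∃ σ : E → E →L[ℂ] (Fin 3 → ℂ), ContDiffAt ℂ ω σ y ∧ (σ y).IsInvertible ∧
      ∀ᶠ z in 𝓝 y, ∀ u v, G z u v = σ z u ⬝ᵥ σ z v := by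
  obtain ⟨e, he⟩ := exists_equiv_dot hE (G y) hs.self_of_nhds hn
  let b : Fin 3 → E := fun i => e.symm (Pi.single i 1)
  have hb : ∀ u, u = e u 0 • b 0 + e u 1 • b 1 + e u 2 • b 2 := by
    intro u
    apply e.injective
    simp only [b, map_add, map_smul, ContinuousLinearEquiv.apply_symm_apply]
    ext i
    fin_cases i <;> simp
  have hg : ∀ i j, ContDiffAt ℂ ω (fun z => G z (b i) (b j)) y := fun i j =>
    (hG.clm_apply contDiffAt_const).clm_apply contDiffAt_const
  have hgy : ∀ i j, G y (b i) (b j) = if i = j then 1 else 0 := by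
    intro i j
    simp [he, b, Pi.single_apply, eq_comm]
  -- Cholesky factorisation of the Gram matrix. The basis is orthonormal at `y`, so each pivot is
  -- `1` there and has a holomorphic square root.
  obtain ⟨p00, s00, y00, q00⟩ := exists_sqrt (hg 0 0) (by simp [hgy])
  have ne00 : p00 y ≠ 0 := by simp [y00]
  obtain ⟨p01, h01⟩ : ∃ p : E → ℂ, p = fun z => G z (b 0) (b 1) / p00 z := ⟨_, rfl⟩
  obtain ⟨p02, h02⟩ : ∃ p : E → ℂ, p = fun z => G z (b 0) (b 2) / p00 z := ⟨_, rfl⟩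
  have s01 : ContDiffAt ℂ ω p01 y := h01 ▸ (hg 0 1).div s00 ne00
  have s02 : ContDiffAt ℂ ω p02 y := h02 ▸ (hg 0 2).div s00 ne00
  have y01 : p01 y = 0 := by simp [h01, hgy]
  have y02 : p02 y = 0 := by simp [h02, hgy]
  obtain ⟨p11, s11, y11, q11⟩ := exists_sqrt ((hg 1 1).sub (s01.mul s01)) (by simp [hgy, y01])
  have ne11 : p11 y ≠ 0 := by simp [y11]
  obtain ⟨p12, h12⟩ : ∃ p : E → ℂ, p = fun z => (G z (b 1) (b 2) - p01 z * p02 z) / p11 z :=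
    ⟨_, rfl⟩
  have s12 : ContDiffAt ℂ ω p12 y := h12 ▸ ((hg 1 2).sub (s01.mul s02)).div s11 ne11
  have y12 : p12 y = 0 := by simp [h12, hgy, y01]
  obtain ⟨p22, s22, y22, q22⟩ := exists_sqrt (((hg 2 2).sub (s02.mul s02)).sub (s12.mul s12))
    (by simp [hgy, y02, y12])
  let U : Fin 3 → Fin 3 → E →L[ℂ] (Fin 3 → ℂ) := fun i j =>
    ((ContinuousLinearMap.proj (R := ℂ) (φ := fun _ : Fin 3 => ℂ) j).smulRight
      (Pi.single i 1 : Fin 3 → ℂ)) ∘L (e : E →L[ℂ] (Fin 3 → ℂ))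
  let σ : E → E →L[ℂ] (Fin 3 → ℂ) := fun z => p00 z • U 0 0 + p01 z • U 0 1 + p02 z • U 0 2
    + p11 z • U 1 1 + p12 z • U 1 2 + p22 z • U 2 2
  have hσ : ContDiffAt ℂ ω σ y :=
    (((((s00.smul contDiffAt_const).add (s01.smul contDiffAt_const)).add
      (s02.smul contDiffAt_const)).add (s11.smul contDiffAt_const)).add
      (s12.smul contDiffAt_const)).add (s22.smul contDiffAt_const)
  have hσG : ∀ᶠ z in 𝓝 y, ∀ u v, G z u v = σ z u ⬝ᵥ σ z v := by
    filter_upwards [hs, q00, q11, q22, s00.continuousAt.eventually_ne ne00,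
      s11.continuousAt.eventually_ne ne11] with z hz r00 r11 r22 n00 n11 u v
    have r01 : p00 z * p01 z = G z (b 0) (b 1) := by rw [h01]; field_simp
    have r02 : p00 z * p02 z = G z (b 0) (b 2) := by rw [h02]; field_simp
    have r12 : p11 z * p12 z = G z (b 1) (b 2) - p01 z * p02 z := by rw [h12]; field_simp
    have r22' : p22 z * p22 z = G z (b 2) (b 2) - p02 z * p02 z - p12 z * p12 z := r22
    have r11' : p11 z * p11 z = G z (b 1) (b 1) - p01 z * p01 z := r11
    have ev : ∀ u, σ z u = ![p00 z * e u 0 + p01 z * e u 1 + p02 z * e u 2,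
        p11 z * e u 1 + p12 z * e u 2, p22 z * e u 2] := by
      intro u
      ext i
      fin_cases i <;> simp [σ, U]
    have hG2 : G z u v = G z (e u 0 • b 0 + e u 1 • b 1 + e u 2 • b 2)
        (e v 0 • b 0 + e v 1 • b 1 + e v 2 • b 2) := by rw [← hb, ← hb]
    rw [hG2, ev, ev]
    simp only [map_add, map_smul, add_apply, smul_apply, smul_eq_mul, hz (b 1) (b 0),
      hz (b 2) (b 0), hz (b 2) (b 1), ← r00, ← r01, ← r02, sub_eq_iff_eq_add.1 r12.symm,
      sub_eq_iff_eq_add.1 r11'.symm, sub_eq_iff_eq_add.1 (sub_eq_iff_eq_add.1 r22'.symm)]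
    simp [dotProduct, Fin.sum_univ_three]
    ring
  refine ⟨σ, hσ, ?_, hσG⟩
  have hinj : Function.Injective (σ y) := by
    refine (injective_iff_map_eq_zero (σ y)).2 fun u hu => hn u fun v => ?_
    rw [hσG.self_of_nhds, hu, zero_dotProduct]
  exact ⟨(LinearEquiv.ofInjectiveOfFinrankEq (σ y : E →ₗ[ℂ] (Fin 3 → ℂ)) hinj
      (by rw [hE]; simp)).toContinuousLinearEquiv, by ext; rfl⟩

/-- A coframe has a torsion-free metric connection. -/
theorem exists_isCoframeAt [CompleteSpace E] {σ : E → E →L[ℂ] (Fin 3 → ℂ)} {y : E}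
    (hσ : ContDiffAt ℂ ω σ y) (hi : (σ y).IsInvertible) : ∃ θ, IsCoframeAt σ θ y := by
  let T : E → (Fin 3 → ℂ) → (Fin 3 → ℂ) → Fin 3 → ℂ := fun z a b =>
    fderiv ℂ σ z ((σ z).inverse a) ((σ z).inverse b)
      - fderiv ℂ σ z ((σ z).inverse b) ((σ z).inverse a)
  have hσ' : ContDiffAt ℂ ω (fderiv ℂ σ) y := hσ.fderiv_right (m := ω) (by simp)
  have hinv := contDiffAt_inverse hσ hi
  have hT : ∀ a b, ContDiffAt ℂ ω (fun z => T z a b) y := fun a b =>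
    ((hσ'.clm_apply (hinv.clm_apply contDiffAt_const)).clm_apply
      (hinv.clm_apply contDiffAt_const)).sub
    ((hσ'.clm_apply (hinv.clm_apply contDiffAt_const)).clm_apply
      (hinv.clm_apply contDiffAt_const))
  obtain ⟨t0, ht0⟩ : ∃ t : E → Fin 3 → ℂ, t = fun z => T z ![0, 1, 0] ![0, 0, 1] := ⟨_, rfl⟩
  obtain ⟨t1, ht1⟩ : ∃ t : E → Fin 3 → ℂ, t = fun z => T z ![0, 0, 1] ![1, 0, 0] := ⟨_, rfl⟩
  obtain ⟨t2, ht2⟩ : ∃ t : E → Fin 3 → ℂ, t = fun z => T z ![1, 0, 0] ![0, 1, 0] := ⟨_, rfl⟩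
  have c0 : ContDiffAt ℂ ω t0 y := ht0 ▸ hT _ _
  have c1 : ContDiffAt ℂ ω t1 y := ht1 ▸ hT _ _
  have c2 : ContDiffAt ℂ ω t2 y := ht2 ▸ hT _ _
  -- Write `dσ = t (σ × σ)` and seek `θ = N σ`. Vanishing torsion reads `tr N - Nᵀ = -t`, solved by
  -- `N = tᵀ - (tr t) / 2`.
  let r : E → ℂ := fun z => (t0 z 0 + t1 z 1 + t2 z 2) / 2
  have hr : ContDiffAt ℂ ω r y :=
    (((contDiffAt_pi.1 c0 0).add (contDiffAt_pi.1 c1 1)).add (contDiffAt_pi.1 c2 2)).div_const 2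
  let e : Fin 3 → ((Fin 3 → ℂ) →L[ℂ] ℂ) →L[ℂ] ((Fin 3 → ℂ) →L[ℂ] (Fin 3 → ℂ)) := fun i =>
    (ContinuousLinearMap.smulRightL ℂ (Fin 3 → ℂ) (Fin 3 → ℂ)).flip (Pi.single i 1)
  let θ : E → E →L[ℂ] (Fin 3 → ℂ) := fun z =>
    (e 0 (dotL (t0 z)) + e 1 (dotL (t1 z)) + e 2 (dotL (t2 z))
      - r z • ContinuousLinearMap.id ℂ (Fin 3 → ℂ)) ∘L σ z
  have hed : ∀ i {t : E → Fin 3 → ℂ}, ContDiffAt ℂ ω t y →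
      ContDiffAt ℂ ω (fun z => e i (dotL (t z))) y := fun i t ht =>
    (e i).contDiff.contDiffAt.comp y (dotL.contDiff.contDiffAt.comp y ht)
  have hθ : ContDiffAt ℂ ω θ y :=
    ((((hed 0 c0).add (hed 1 c1)).add (hed 2 c2)).sub (hr.smul contDiffAt_const)).clm_comp hσ
  refine ⟨θ, hσ, hθ, hi, ?_⟩
  filter_upwards [eventually_isInvertible hσ.continuousAt hi] with z hz u v
  have ha := alternating_eq_cross (LinearMap.mk₂ ℂ (T z)
      (fun a b c => by simp [T]; abel) (fun r a b => by simp [T, smul_sub])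
      (fun a b c => by simp [T]; abel) (fun r a b => by simp [T, smul_sub]))
      (fun a => by simp [T]) (σ z u) (σ z v)
  simp only [LinearMap.mk₂_apply] at ha
  have ha' : fderiv ℂ σ z u v - fderiv ℂ σ z v u = (σ z u ⨯₃ σ z v) 0 • t0 z
      + (σ z u ⨯₃ σ z v) 1 • t1 z + (σ z u ⨯₃ σ z v) 2 • t2 z := by
    rw [ht0, ht1, ht2, ← ha]
    simp only [T, hz.inverse_apply_self]
  have h0 : ∀ u, θ z u 0 = t0 z ⬝ᵥ σ z u - r z * σ z u 0 := fun u => by simp [θ, e]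
  have h1 : ∀ u, θ z u 1 = t1 z ⬝ᵥ σ z u - r z * σ z u 1 := fun u => by simp [θ, e]
  have h2 : ∀ u, θ z u 2 = t2 z ⬝ᵥ σ z u - r z * σ z u 2 := fun u => by simp [θ, e]
  rw [torsion, ha']
  ext i
  simp only [Pi.add_apply, Pi.sub_apply, Pi.smul_apply, smul_eq_mul, Pi.zero_apply]
  fin_cases i <;> simp [cross_apply, h0, h1, h2, dotProduct, Fin.sum_univ_three, r] <;> ring

end HolRiem

/-! ### Killing fields on a vector space and the sixth field -/

namespace HolRiem

variable {E : Type*} [NormedAddCommGroup E] [NormedSpace ℂ E]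

/-- The Killing equation at `y` for a vector field `X` and a metric `G` on a vector space. -/
def FlatKillingAt (G : E → E →L[ℂ] E →L[ℂ] ℂ) (X : E → E) (y : E) : Prop :=
  ContDiffAt ℂ ω X y ∧ ∀ u v, fderiv ℂ G y (X y) u v + G y (fderiv ℂ X y u) v
    + G y u (fderiv ℂ X y v) = 0

/-- The Lie derivative of the metric in terms of the coframe. -/
theorem lieDeriv_eq_covD {σ θ : E → E →L[ℂ] (Fin 3 → ℂ)} {y : E} (h : IsCoframeAt σ θ y)
    {G : E → E →L[ℂ] E →L[ℂ] ℂ} (hG : ∀ᶠ z in 𝓝 y, ∀ u v, G z u v = σ z u ⬝ᵥ σ z v)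
    (hGd : DifferentiableAt ℂ G y)
    {X : E → E} (hX : DifferentiableAt ℂ X y) (u v : E) :
    fderiv ℂ G y (X y) u v + G y (fderiv ℂ X y u) v + G y u (fderiv ℂ X y v)
      = covD θ (fun z => σ z (X z)) y u ⬝ᵥ σ y v + σ y u ⬝ᵥ covD θ (fun z => σ z (X z)) y v := by
  have hσd : DifferentiableAt ℂ σ y := h.coframe.differentiableAt (by simp)
  have ev : ∀ b, HasFDerivAt (fun z => σ z b) ((fderiv ℂ σ y).flip b) y := fun b => by
    simpa using hσd.hasFDerivAt.clm_apply (hasFDerivAt_const b y)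
  have hGuv : ∀ w, fderiv ℂ G y w u v = fderiv ℂ σ y w u ⬝ᵥ σ y v + σ y u ⬝ᵥ fderiv ℂ σ y w v := by
    intro w
    have e1 : HasFDerivAt (fun z => G z u v) (((fderiv ℂ G y).flip u).flip v) y := by
      have h1 : HasFDerivAt (fun z => G z u) ((fderiv ℂ G y).flip u) y := by
        simpa using hGd.hasFDerivAt.clm_apply (hasFDerivAt_const u y)
      simpa using h1.clm_apply (hasFDerivAt_const v y)
    have e2 := (dotL.hasFDerivAt_of_bilinear (ev u) (ev v)).congr_of_eventuallyEq
      (f₁ := fun z => G z u v) (by filter_upwards [hG] with z hz using hz u v)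
    have := congrArg (fun L => L w) (e1.unique e2)
    simp at this
    rw [this, add_comm]
  -- Vanishing torsion exchanges the derivative along `w` for one along `X`. The remaining `θ (X)`
  -- term is an infinitesimal rotation and drops out of the symmetrised product.
  have hc : ∀ w, covD θ (fun z => σ z (X z)) y w = fderiv ℂ σ y (X y) w + σ y (fderiv ℂ X y w)
      + θ y (X y) ⨯₃ σ y w := by
    intro w
    rw [covD_apply, (hσd.hasFDerivAt.clm_apply hX.hasFDerivAt).fderiv]
    have t := h.torsion_eq_zero.self_of_nhds (X y) w
    simp [torsion] at t ⊢
    linear_combination (exp := 1) -t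
  have hGy := hG.self_of_nhds
  rw [hGuv, hGy, hGy, hc, hc]
  simp only [add_dotProduct, dotProduct_add]
  have sk : (θ y (X y) ⨯₃ σ y u) ⬝ᵥ σ y v + σ y u ⬝ᵥ θ y (X y) ⨯₃ σ y v = 0 := by
    simp [cross_apply, dotProduct, Fin.sum_univ_three]
    ring
  linear_combination -sk

/-- A Killing field and its rotation vector form a Killing pair. -/
theorem exists_isKillingPair [CompleteSpace E] {σ θ : E → E →L[ℂ] (Fin 3 → ℂ)} {y : E}
    (h : IsCoframeAt σ θ y) {G : E → E →L[ℂ] E →L[ℂ] ℂ} (hGs : ContDiffAt ℂ ω G y)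
    (hG : ∀ᶠ z in 𝓝 y, ∀ u v, G z u v = σ z u ⬝ᵥ σ z v) {X : E → E}
    (hX : ∀ᶠ z in 𝓝 y, FlatKillingAt G X z) :
    ∃ η, IsKillingPair σ θ (fun z => σ z (X z)) η y := by
  have hX0 := hX.self_of_nhds.1
  obtain ⟨ξ, hξ⟩ : ∃ ξ, ξ = fun z => σ z (X z) := ⟨_, rfl⟩
  have hξs : ContDiffAt ℂ ω ξ y := hξ ▸ h.coframe.clm_apply hX0
  let K : E → (Fin 3 → ℂ) →L[ℂ] (Fin 3 → ℂ) := fun z => covD θ ξ z ∘L (σ z).inverse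
  have hcov : ContDiffAt ℂ ω (covD θ ξ) y :=
    (hξs.fderiv_right (m := ω) (by simp)).add
      ((crossL.flip.contDiff.contDiffAt.comp y hξs).clm_comp h.connection)
  have hK : ContDiffAt ℂ ω K y := hcov.clm_comp (contDiffAt_inverse h.coframe h.invertible)
  have hKe : ∀ a i, ContDiffAt ℂ ω (fun z => K z a i) y := fun a i =>
    contDiffAt_pi.1 (hK.clm_apply contDiffAt_const) i
  refine ⟨fun z => ![K z ![0, 0, 1] 1, K z ![1, 0, 0] 2, K z ![0, 1, 0] 0], hξ ▸ hξs, ?_, ?_⟩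
  · refine contDiffAt_pi.2 fun i => ?_
    fin_cases i
    exacts [hKe _ _, hKe _ _, hKe _ _]
  · rw [← hξ]
    filter_upwards [hX, h.eventually, hG.eventually_nhds, hGs.eventually (by simp)]
      with z h1 h2 h3 h4 v
    have := skew_eq_cross (K z : (Fin 3 → ℂ) →ₗ[ℂ] (Fin 3 → ℂ)) (fun a b => by
      have e := lieDeriv_eq_covD h2 h3 (h4.differentiableAt (by simp))
        (h1.1.differentiableAt (by simp)) ((σ z).inverse a) ((σ z).inverse b)
      rw [h1.2, ← hξ, h2.invertible.self_apply_inverse, h2.invertible.self_apply_inverse] at e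
      exact e.symm) (σ z v)
    simpa [K, h2.invertible.inverse_apply_self] using this

/-- The vector field of a Killing pair is a Killing field. -/
theorem IsKillingPair.flatKillingAt [CompleteSpace E] {σ θ : E → E →L[ℂ] (Fin 3 → ℂ)} {y : E}
    (h : IsCoframeAt σ θ y) {G : E → E →L[ℂ] E →L[ℂ] ℂ} (hGs : ContDiffAt ℂ ω G y)
    (hG : ∀ᶠ z in 𝓝 y, ∀ u v, G z u v = σ z u ⬝ᵥ σ z v) {ξ η : E → Fin 3 → ℂ}
    (hk : IsKillingPair σ θ ξ η y) :
    ∀ᶠ z in 𝓝 y, FlatKillingAt G (fun z => (σ z).inverse (ξ z)) z := by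
  filter_upwards [h.eventually, h.eventually.eventually_nhds, hG.eventually_nhds,
    hGs.eventually (by simp), hk.eventually] with z h1 h1' h2 h3 h4
  have hXs : ContDiffAt ℂ ω (fun z => (σ z).inverse (ξ z)) z :=
    (contDiffAt_inverse h1.coframe h1.invertible).clm_apply h4.field
  refine ⟨hXs, fun u v => ?_⟩
  rw [lieDeriv_eq_covD h1 h2 (h3.differentiableAt (by simp)) (hXs.differentiableAt (by simp)) u v]
  have e : (fun z => σ z ((σ z).inverse (ξ z))) =ᶠ[𝓝 z] ξ := by
    filter_upwards [h1'] with w hw using hw.invertible.self_apply_inverse _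
  have e' : covD θ (fun z => σ z ((σ z).inverse (ξ z))) z = covD θ ξ z := by
    rw [covD, covD, e.fderiv_eq, h1.invertible.self_apply_inverse]
  rw [e', h4.covD_field.self_of_nhds, h4.covD_field.self_of_nhds]
  simp [cross_apply, dotProduct, Fin.sum_univ_three]
  ring

/-- The rotation vector of a Killing field is determined by the field. -/
theorem IsKillingPair.rotation_unique {σ θ : E → E →L[ℂ] (Fin 3 → ℂ)} {y : E}
    (h : IsCoframeAt σ θ y) {ξ ξ' η η' : E → Fin 3 → ℂ} (hk : IsKillingPair σ θ ξ η y)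
    (hk' : IsKillingPair σ θ ξ' η' y) (he : ξ =ᶠ[𝓝 y] ξ') : η y = η' y := by
  have e : covD θ ξ y = covD θ ξ' y := by rw [covD, covD, he.fderiv_eq, he.self_of_nhds]
  refine sub_eq_zero.1 (eq_zero_of_forall_cross fun b => ?_)
  have h1 := hk.covD_field.self_of_nhds ((σ y).inverse b)
  have h2 := hk'.covD_field.self_of_nhds ((σ y).inverse b)
  rw [h.invertible.self_apply_inverse] at h1 h2
  rw [map_sub, ← h1, ← h2, e, sub_self]

/-- The invariant bilinear form on the bundle of one-jets of Killing fields. -/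
noncomputable def pairingL :
    ((Fin 3 → ℂ) × (Fin 3 → ℂ)) →L[ℂ] ((Fin 3 → ℂ) × (Fin 3 → ℂ)) →L[ℂ] ℂ :=
  dotL.bilinearComp (ContinuousLinearMap.fst ℂ _ _) (ContinuousLinearMap.snd ℂ _ _)
    + dotL.bilinearComp (ContinuousLinearMap.snd ℂ _ _) (ContinuousLinearMap.fst ℂ _ _)

theorem pairingL_apply (a b : (Fin 3 → ℂ) × (Fin 3 → ℂ)) :
    pairingL a b = a.1 ⬝ᵥ b.2 + a.2 ⬝ᵥ b.1 := rfl

/-- In dimension three, five independent germs of Killing fields can be completed by a sixth. -/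
theorem exists_sixth_flatKilling [FiniteDimensional ℂ E] (hE : Module.finrank ℂ E = 3)
    {G : E → E →L[ℂ] E →L[ℂ] ℂ} {y : E} (hGs : ContDiffAt ℂ ω G y)
    (hs : ∀ᶠ z in 𝓝 y, ∀ u v, G z u v = G z v u) (hn : ∀ u, (∀ v, G y u v = 0) → u = 0)
    {X : Fin 5 → E → E} (hX : ∀ i, ∀ᶠ z in 𝓝 y, FlatKillingAt G (X i) z)
    (hli : ∀ c : Fin 5 → ℂ, (∀ᶠ z in 𝓝 y, ∑ i, c i • X i z = 0) → c = 0) :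
    ∃ X' : E → E, (∀ᶠ z in 𝓝 y, FlatKillingAt G X' z) ∧
      ∀ c : Fin 5 → ℂ, ¬ ∀ᶠ z in 𝓝 y, X' z = ∑ i, c i • X i z := by
  have : CompleteSpace E := FiniteDimensional.complete ℂ E
  obtain ⟨σ, hσs, hσi, hσG⟩ := exists_coframe hE hGs hs hn
  obtain ⟨θ, h⟩ := exists_isCoframeAt hσs hσi
  choose η hη using fun i => exists_isKillingPair h hGs hσG (hX i)
  have hξsum : ∀ (c : Fin 5 → ℂ) z, ∑ i, c i • σ z (X i z) = σ z (∑ i, c i • X i z) := by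
    intro c z
    simp only [map_sum, map_smul]
  -- By rigidity, independence of germs becomes independence of one-jets at `y`.
  have hF : LinearIndependent ℂ fun i => (σ y (X i y), η i y) := by
    rw [Fintype.linearIndependent_iff]
    intro c hc
    have h1 : ∑ i, c i • σ y (X i y) = 0 := by simpa [Prod.fst_sum] using congrArg Prod.fst hc
    have h2 : ∑ i, c i • η i y = 0 := by simpa [Prod.snd_sum] using congrArg Prod.snd hc
    have := (IsKillingPair.sum_smul hη c).eventually_eq_zero h h1 h2
    refine congrFun (hli c ?_)
    filter_upwards [this, h.eventually] with z hz hz'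
    rw [hξsum] at hz
    rw [← hz'.invertible.inverse_apply_self (∑ i, c i • X i z), hz.1, map_zero]
  obtain ⟨k, hk⟩ := exists_curvOp_eq_const_smul h hη hF
  obtain ⟨Z, hZs, hZp, hZy⟩ := exists_parallel_completion pairingL
    (fun a b => by rw [pairingL_apply, pairingL_apply, dotProduct_comm a.1, dotProduct_comm a.2,
      add_comm])
    (fun a ha => by
      refine Prod.ext (eq_zero_of_forall_dot fun b => ?_) (eq_zero_of_forall_dot fun b => ?_)
      · simpa [pairingL_apply, dotProduct_comm] using ha (0, b)
      · simpa [pairingL_apply, dotProduct_comm] using ha (b, 0))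
    (by simp) (y := y) (A := fun z v a =>
      (σ z v ⨯₃ a.2 - θ z v ⨯₃ a.1, k • (a.1 ⨯₃ σ z v) - θ z v ⨯₃ a.2))
    -- The connection is skew for the pairing because the curvature operator is a scalar.
    (Filter.Eventually.of_forall fun z v a b => by
      simp [pairingL_apply, cross_apply, dotProduct, Fin.sum_univ_three]
      ring)
    (F := fun i z => (σ z (X i z), η i z)) (fun i => (hη i).field.prodMk (hη i).rotation)
    (fun i => by
      filter_upwards [(hη i).eventually, h.eventually, hk] with z h1 h2 h3 v
      rw [((h1.field.differentiableAt (by simp)).hasFDerivAt.prodMk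
        (h1.rotation.differentiableAt (by simp)).hasFDerivAt).fderiv]
      refine Prod.ext ?_ ?_
      · have := h1.covD_field.self_of_nhds v
        rw [covD_apply] at this
        exact eq_sub_of_add_eq this
      · have := h1.covD_rotation h2 v
        rw [covD_apply, h3] at this
        exact eq_sub_of_add_eq this) hF
  have hpair : IsKillingPair σ θ (fun z => (Z z).1) (fun z => (Z z).2) y := by
    refine ⟨hZs.fst, hZs.snd, ?_⟩
    filter_upwards [hZp, hZs.eventually (by simp)] with z h1 h2 v
    have d := (h2.differentiableAt (by simp)).hasFDerivAt
    rw [covD_apply, d.fst.fderiv]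
    have := congrArg Prod.fst (h1 v)
    exact add_eq_of_eq_sub this
  refine ⟨_, hpair.flatKillingAt h hGs hσG, fun c hc => hZy ?_⟩
  have hp := IsKillingPair.sum_smul hη c
  have e : (fun z => (Z z).1) =ᶠ[𝓝 y] fun z => ∑ i, c i • σ z (X i z) := by
    filter_upwards [hc, h.eventually] with z hz hz'
    rw [hξsum, ← hz, hz'.invertible.self_apply_inverse]
  have e2 := hpair.rotation_unique h hp e
  have : Z y = ∑ i, c i • (σ y (X i y), η i y) := by
    refine Prod.ext ?_ ?_
    · simpa [Prod.fst_sum] using e.self_of_nhds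
    · simpa [Prod.snd_sum] using e2
  rw [this]
  exact Submodule.sum_mem _ fun i _ => Submodule.smul_mem _ _ (Submodule.subset_span ⟨i, rfl⟩)

end HolRiem

/-! ### Transfer between the manifold and a chart -/

namespace HolRiem

section Chart

open VectorField

variable {E : Type*} [NormedAddCommGroup E] [NormedSpace ℂ E]
  {M : Type*} [TopologicalSpace M] [ChartedSpace E M]

/-- The derivative of the chart at `x₀`. -/
noncomputable def chartD (x₀ x : M) : E →L[ℂ] E :=
  mfderiv 𝓘(ℂ, E) 𝓘(ℂ, E) (chartAt E x₀) x

/-- The derivative of the inverse of the chart at `x₀`. -/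
noncomputable def chartSymmD (x₀ : M) (z : E) : E →L[ℂ] E :=
  mfderiv 𝓘(ℂ, E) 𝓘(ℂ, E) (chartAt E x₀).symm z

/-- A vector field read in the chart at `x₀`. -/
noncomputable def chartField (x₀ : M) (X : ∀ x : M, TangentSpace 𝓘(ℂ, E) x) (z : E) : E :=
  chartD x₀ ((chartAt E x₀).symm z) (X ((chartAt E x₀).symm z))

/-- The vector field on `M` that is read as `W` in the chart at `x₀`. -/
noncomputable def ofChartField (x₀ : M) (W : E → E) : ∀ x : M, TangentSpace 𝓘(ℂ, E) x :=
  fun x => chartSymmD x₀ (chartAt E x₀ x) (W (chartAt E x₀ x))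

/-- The bilinear form of a metric, with the tangent space seen as the model space. -/
noncomputable def Metric.modelForm [IsManifold 𝓘(ℂ, E) ω M] (g : Metric (E := E) M) (x : M) :
    E →L[ℂ] E →L[ℂ] ℂ :=
  g.form x

/-- A metric read in the chart at `x₀`. -/
noncomputable def Metric.chartForm [IsManifold 𝓘(ℂ, E) ω M] (g : Metric (E := E) M) (x₀ : M)
    (z : E) : E →L[ℂ] E →L[ℂ] ℂ :=
  (g.modelForm ((chartAt E x₀).symm z)).bilinearComp (chartSymmD x₀ z) (chartSymmD x₀ z)

variable [IsManifold 𝓘(ℂ, E) ω M]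

theorem mdifferentiable_chartAt (x₀ : M) :
    (chartAt E x₀).MDifferentiable 𝓘(ℂ, E) 𝓘(ℂ, E) :=
  have : IsManifold 𝓘(ℂ, E) 1 M := .of_le (n := ω) le_top
  mdifferentiable_chart x₀

theorem chartD_chartSymmD {x₀ : M} {z : E} (hz : z ∈ (chartAt E x₀).target) (v : E) :
    chartD x₀ ((chartAt E x₀).symm z) (chartSymmD x₀ z v) = v :=
  DFunLike.congr_fun ((mdifferentiable_chartAt x₀).comp_symm_deriv hz) v

theorem chartSymmD_chartD {x₀ : M} {z : E} (hz : z ∈ (chartAt E x₀).target) (v : E) :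
    chartSymmD x₀ z (chartD x₀ ((chartAt E x₀).symm z) v) = v := by
  have := DFunLike.congr_fun
    ((mdifferentiable_chartAt x₀).symm_comp_deriv ((chartAt E x₀).map_target hz)) v
  rw [(chartAt E x₀).right_inv hz] at this
  exact this

/-- Gives access to the regularity of pullbacks and the naturality of the Lie bracket. -/
theorem mpullback_chart_symm {x₀ : M} {z : E} (hz : z ∈ (chartAt E x₀).target)
    (X : ∀ x : M, TangentSpace 𝓘(ℂ, E) x) :
    mpullback 𝓘(ℂ, E) 𝓘(ℂ, E) (chartAt E x₀).symm X z = chartField x₀ X z := by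
  have h : (chartSymmD x₀ z).inverse = chartD x₀ ((chartAt E x₀).symm z) :=
    ContinuousLinearMap.inverse_eq (ContinuousLinearMap.ext (chartSymmD_chartD hz))
      (ContinuousLinearMap.ext (chartD_chartSymmD hz))
  exact DFunLike.congr_fun h _

theorem mpullback_chart {x₀ x : M} (hx : x ∈ (chartAt E x₀).source) (W : E → E) :
    mpullback 𝓘(ℂ, E) 𝓘(ℂ, E) (chartAt E x₀) (fun z => (W z : TangentSpace 𝓘(ℂ, E) z)) x
      = ofChartField x₀ W x := by
  have hz := (chartAt E x₀).map_source hx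
  have h : (chartD x₀ x).inverse = chartSymmD x₀ (chartAt E x₀ x) :=
    ContinuousLinearMap.inverse_eq
      (ContinuousLinearMap.ext fun v => by
        have := chartD_chartSymmD hz v
        rw [(chartAt E x₀).left_inv hx] at this
        exact this)
      (ContinuousLinearMap.ext fun v => by
        have := chartSymmD_chartD hz v
        rw [(chartAt E x₀).left_inv hx] at this
        exact this)
  exact DFunLike.congr_fun h _

theorem chartField_ofChartField {x₀ : M} {z : E} (hz : z ∈ (chartAt E x₀).target) (W : E → E) :
    chartField x₀ (ofChartField x₀ W) z = W z := by
  unfold chartField ofChartField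
  rw [(chartAt E x₀).right_inv hz]
  exact chartD_chartSymmD hz _

theorem chartForm_chartField (g : Metric (E := E) M) {x₀ : M} {z : E}
    (hz : z ∈ (chartAt E x₀).target) (X Y : ∀ x : M, TangentSpace 𝓘(ℂ, E) x) :
    g.chartForm x₀ z (chartField x₀ X z) (chartField x₀ Y z)
      = g.form ((chartAt E x₀).symm z) (X ((chartAt E x₀).symm z)) (Y ((chartAt E x₀).symm z)) := by
  have h : ∀ X : (∀ x : M, TangentSpace 𝓘(ℂ, E) x),
      chartSymmD x₀ z (chartField x₀ X z) = X ((chartAt E x₀).symm z) :=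
    fun X => chartSymmD_chartD hz _
  exact congrArg₂ (fun u v : E => g.modelForm ((chartAt E x₀).symm z) u v) (h X) (h Y)

theorem contMDiffAt_chartAt {x₀ x : M} (hx : x ∈ (chartAt E x₀).source) :
    ContMDiffAt 𝓘(ℂ, E) 𝓘(ℂ, E) ω (chartAt E x₀) x :=
  (contMDiffOn_chart).contMDiffAt ((chartAt E x₀).open_source.mem_nhds hx)

theorem contMDiffAt_chartAt_symm {x₀ : M} {z : E} (hz : z ∈ (chartAt E x₀).target) :
    ContMDiffAt 𝓘(ℂ, E) 𝓘(ℂ, E) ω (chartAt E x₀).symm z :=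
  (contMDiffOn_chart_symm).contMDiffAt ((chartAt E x₀).open_target.mem_nhds hz)

variable [CompleteSpace E]

theorem HolomorphicAt.contDiffAt_chartField {X : ∀ x : M, TangentSpace 𝓘(ℂ, E) x} {x₀ : M} {z : E}
    (hz : z ∈ (chartAt E x₀).target) (hX : HolomorphicAt X ((chartAt E x₀).symm z)) :
    ContDiffAt ℂ ω (chartField x₀ X) z := by
  have : IsManifold 𝓘(ℂ, E) 1 M := .of_le (n := ω) le_top
  have h := ContMDiffAt.mpullback_vectorField_preimage hX (contMDiffAt_chartAt_symm hz)
    ⟨(mdifferentiable_chartAt x₀).symm.mfderiv hz, rfl⟩ le_top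
  rw [contMDiffAt_vectorSpace_iff_contDiffAt] at h
  refine h.congr_of_eventuallyEq ?_
  filter_upwards [(chartAt E x₀).open_target.mem_nhds hz] with w hw
  exact (mpullback_chart_symm hw X).symm

theorem holomorphicAt_ofChartField {W : E → E} {x₀ x : M} (hx : x ∈ (chartAt E x₀).source)
    (hW : ContDiffAt ℂ ω W (chartAt E x₀ x)) : HolomorphicAt (ofChartField x₀ W) x := by
  have : IsManifold 𝓘(ℂ, E) 1 M := .of_le (n := ω) le_top
  have h := ContMDiffAt.mpullback_vectorField_preimage
    (contMDiffAt_vectorSpace_iff_contDiffAt (V := fun z => (W z : TangentSpace 𝓘(ℂ, E) z)).2 hW)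
    (contMDiffAt_chartAt hx) ⟨(mdifferentiable_chartAt x₀).mfderiv hx, rfl⟩ le_top
  refine h.congr_of_eventuallyEq ?_
  filter_upwards [(chartAt E x₀).open_source.mem_nhds hx] with w hw
  rw [mpullback_chart hw]

omit [CompleteSpace E] in
theorem Metric.contMDiffAt_form (g : Metric (E := E) M) {X Y : ∀ x : M, TangentSpace 𝓘(ℂ, E) x}
    {x : M} (hX : HolomorphicAt X x) (hY : HolomorphicAt Y x) :
    ContMDiffAt 𝓘(ℂ, E) 𝓘(ℂ, ℂ) ω (fun y => g.form y (X y) (Y y)) x := by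
  have : IsManifold 𝓘(ℂ, E) (ω + 1) M := ‹IsManifold 𝓘(ℂ, E) ω M›
  have := ContMDiffAt.clm_bundle_apply₂ (F₁ := E) (F₂ := E) (F₃ := ℂ)
    (E₃ := Bundle.Trivial M ℂ) (g.holomorphic x) hX hY
  rw [Bundle.contMDiffAt_totalSpace] at this
  exact this.2

theorem Metric.contDiffAt_chartForm [FiniteDimensional ℂ E] (g : Metric (E := E) M) {x₀ : M} {z : E}
    (hz : z ∈ (chartAt E x₀).target) : ContDiffAt ℂ ω (g.chartForm x₀) z := by
  refine ContDiffOn.contDiffAt (s := (chartAt E x₀).target) ?_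
    ((chartAt E x₀).open_target.mem_nhds hz)
  refine contDiffOn_clm_apply.2 fun u => contDiffOn_clm_apply.2 fun v => fun w hw => ?_
  refine ContDiffAt.contDiffWithinAt ?_
  have hs := (chartAt E x₀).map_target hw
  have h := (g.contMDiffAt_form (holomorphicAt_ofChartField hs (W := fun _ => u) contDiffAt_const)
    (holomorphicAt_ofChartField hs (W := fun _ => v) contDiffAt_const)).comp w
    (contMDiffAt_chartAt_symm hw)
  refine (contMDiffAt_iff_contDiffAt.1 h).congr_of_eventuallyEq ?_
  filter_upwards [(chartAt E x₀).open_target.mem_nhds hw] with t ht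
  have := chartForm_chartField g ht (ofChartField x₀ fun _ => u) (ofChartField x₀ fun _ => v)
  rw [chartField_ofChartField ht, chartField_ofChartField ht] at this
  exact this

/-- By the product rule the derivatives of `Y` and `Z` cancel against the brackets. The expression
is thus tensorial in `Y` and `Z`, and the Killing equation may be tested on fields constant in the
chart. -/
theorem Metric.lieDeriv_eq_chart [FiniteDimensional ℂ E] (g : Metric (E := E) M) {x₀ : M} {z : E}
    (hz : z ∈ (chartAt E x₀).target) {X Y Z : ∀ x : M, TangentSpace 𝓘(ℂ, E) x}
    (hX : HolomorphicAt X ((chartAt E x₀).symm z)) (hY : HolomorphicAt Y ((chartAt E x₀).symm z))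
    (hZ : HolomorphicAt Z ((chartAt E x₀).symm z)) :
    g.lieDeriv X Y Z ((chartAt E x₀).symm z)
      = fderiv ℂ (g.chartForm x₀) z (chartField x₀ X z) (chartField x₀ Y z) (chartField x₀ Z z)
        + g.chartForm x₀ z (fderiv ℂ (chartField x₀ X) z (chartField x₀ Y z)) (chartField x₀ Z z)
        + g.chartForm x₀ z (chartField x₀ Y z)
          (fderiv ℂ (chartField x₀ X) z (chartField x₀ Z z)) := by
  have hG := (g.contDiffAt_chartForm hz).differentiableAt (by simp)
  have hY' := (hY.contDiffAt_chartField hz).differentiableAt (by simp)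
  have hZ' := (hZ.contDiffAt_chartField hz).differentiableAt (by simp)
  have bracket : ∀ W : (∀ x : M, TangentSpace 𝓘(ℂ, E) x),
      HolomorphicAt W ((chartAt E x₀).symm z) →
      chartField x₀ (mlieBracket 𝓘(ℂ, E) X W) z
        = fderiv ℂ (chartField x₀ W) z (chartField x₀ X z)
          - fderiv ℂ (chartField x₀ X) z (chartField x₀ W z) := by
    intro W hW
    have ev : ∀ V : (∀ x : M, TangentSpace 𝓘(ℂ, E) x),
        mpullback 𝓘(ℂ, E) 𝓘(ℂ, E) (chartAt E x₀).symm V =ᶠ[𝓝 z] chartField x₀ V := fun V => by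
      filter_upwards [(chartAt E x₀).open_target.mem_nhds hz] with w hw
      exact mpullback_chart_symm hw V
    have : IsManifold 𝓘(ℂ, E) (minSmoothness ℂ 3) M := .of_le (n := ω) le_top
    rw [← mpullback_chart_symm hz, mpullback_mlieBracket hX.mdifferentiableAt hW.mdifferentiableAt
      (contMDiffAt_chartAt_symm hz) le_top, (ev X).mlieBracket_vectorField_eq (ev W)]
    exact (congrFun (mlieBracketWithin_eq_lieBracketWithin (𝕜 := ℂ) (E := E)
      (V := chartField x₀ X) (W := chartField x₀ W) (s := Set.univ)) z).trans
        (congrFun lieBracketWithin_univ z)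
  have hd : mvfderiv 𝓘(ℂ, E) (fun y => g.form y (Y y) (Z y)) ((chartAt E x₀).symm z)
        (X ((chartAt E x₀).symm z))
      = fderiv ℂ (fun w => g.chartForm x₀ w (chartField x₀ Y w) (chartField x₀ Z w)) z
        (chartField x₀ X z) := by
    have hc : fderiv ℂ (fun w => g.chartForm x₀ w (chartField x₀ Y w) (chartField x₀ Z w)) z
        = mfderiv 𝓘(ℂ, E) 𝓘(ℂ, ℂ)
          ((fun y => g.form y (Y y) (Z y)) ∘ (chartAt E x₀).symm) z := by
      rw [mfderiv_eq_fderiv]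
      refine Filter.EventuallyEq.fderiv_eq ?_
      filter_upwards [(chartAt E x₀).open_target.mem_nhds hz] with w hw
      exact chartForm_chartField g hw Y Z
    rw [hc, mfderiv_comp z ((g.contMDiffAt_form hY hZ).mdifferentiableAt (by simp))
      ((contMDiffAt_chartAt_symm hz).mdifferentiableAt (by simp))]
    have := chartSymmD_chartD hz (X ((chartAt E x₀).symm z))
    conv_lhs => rw [← this]
    rfl
  rw [Metric.lieDeriv, hd, ← chartForm_chartField g hz, ← chartForm_chartField g hz,
    bracket Y hY, bracket Z hZ, fderiv_clm_apply (hG.clm_apply hY') hZ', fderiv_clm_apply hG hY']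
  simp only [map_sub, add_apply, sub_apply, ContinuousLinearMap.comp_apply,
    ContinuousLinearMap.flip_apply]
  ring

theorem Metric.KillingAt.flatKillingAt [FiniteDimensional ℂ E] {g : Metric (E := E) M} {x₀ : M}
    {z : E} (hz : z ∈ (chartAt E x₀).target) {X : ∀ x : M, TangentSpace 𝓘(ℂ, E) x}
    (h : g.KillingAt X ((chartAt E x₀).symm z)) :
    FlatKillingAt (g.chartForm x₀) (chartField x₀ X) z := by
  refine ⟨h.1.contDiffAt_chartField hz, fun u v => ?_⟩
  have hs := (chartAt E x₀).map_target hz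
  have hu := holomorphicAt_ofChartField hs (W := fun _ => u) contDiffAt_const
  have hv := holomorphicAt_ofChartField hs (W := fun _ => v) contDiffAt_const
  have := g.lieDeriv_eq_chart hz h.1 hu hv
  rw [h.2 _ _ hu hv, chartField_ofChartField hz, chartField_ofChartField hz] at this
  exact this.symm

theorem FlatKillingAt.killingAt [FiniteDimensional ℂ E] {g : Metric (E := E) M} {x₀ : M}
    {z : E} (hz : z ∈ (chartAt E x₀).target) {W : E → E}
    (h : FlatKillingAt (g.chartForm x₀) W z) :
    g.KillingAt (ofChartField x₀ W) ((chartAt E x₀).symm z) := by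
  have hs := (chartAt E x₀).map_target hz
  have hW : HolomorphicAt (ofChartField x₀ W) ((chartAt E x₀).symm z) :=
    holomorphicAt_ofChartField hs (by rw [(chartAt E x₀).right_inv hz]; exact h.1)
  refine ⟨hW, fun Y Z hY hZ => ?_⟩
  have ev : chartField x₀ (ofChartField x₀ W) =ᶠ[𝓝 z] W := by
    filter_upwards [(chartAt E x₀).open_target.mem_nhds hz] with w hw
    exact chartField_ofChartField hw W
  rw [g.lieDeriv_eq_chart hz hW hY hZ, ev.fderiv_eq, ev.self_of_nhds]
  exact h.2 _ _

omit [CompleteSpace E] in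
theorem Metric.chartForm_symm (g : Metric (E := E) M) (x₀ : M) (z u v : E) :
    g.chartForm x₀ z u v = g.chartForm x₀ z v u :=
  g.symm ((chartAt E x₀).symm z) (chartSymmD x₀ z u) (chartSymmD x₀ z v)

omit [CompleteSpace E] in
theorem Metric.chartForm_nondegenerate (g : Metric (E := E) M) {x₀ : M} {z : E}
    (hz : z ∈ (chartAt E x₀).target) {u : E} (hu : ∀ v, g.chartForm x₀ z u v = 0) : u = 0 := by
  have h : ∀ w : E, g.modelForm ((chartAt E x₀).symm z) (chartSymmD x₀ z u) w = 0 := fun w => by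
    rw [← chartSymmD_chartD hz w]
    exact hu _
  have h0 : chartSymmD x₀ z u = 0 :=
    g.nondegenerate ((chartAt E x₀).symm z) (chartSymmD x₀ z u) h
  rw [← chartD_chartSymmD hz u, h0, map_zero]

omit [CompleteSpace E] in
theorem chartField_eventually_eq_zero_iff {x₀ : M} {X : ∀ x : M, TangentSpace 𝓘(ℂ, E) x} :
    (∀ᶠ z in 𝓝 (chartAt E x₀ x₀), chartField x₀ X z = 0) ↔ ∀ᶠ x in 𝓝 x₀, X x = 0 := by
  have hs := mem_chart_source E x₀
  have ht := (chartAt E x₀).map_source hs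
  have hm := (chartAt E x₀).map_nhds_eq hs
  rw [← hm, Filter.eventually_map]
  refine Filter.eventually_congr ?_
  filter_upwards [(chartAt E x₀).open_source.mem_nhds hs] with x hx
  have hz := (chartAt E x₀).map_source hx
  have e := (chartAt E x₀).left_inv hx
  have h : chartField x₀ X (chartAt E x₀ x) = (chartD x₀ x : E →L[ℂ] E) (X x) := by
    unfold chartField
    rw [e]
  rw [h]
  have h' : chartSymmD x₀ (chartAt E x₀ x) ((chartD x₀ x : E →L[ℂ] E) (X x)) = X x := by
    have := chartSymmD_chartD hz (X x)
    rwa [e] at this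
  exact ⟨fun h0 => h'.symm.trans ((congrArg _ h0).trans
      (map_zero (chartSymmD x₀ (chartAt E x₀ x) : E →L[ℂ] E))),
    fun h0 => (congrArg (chartD x₀ x : E →L[ℂ] E) h0).trans (map_zero _)⟩

end Chart

end HolRiem

/-! ### Germs and the conclusion -/

namespace HolRiem

section Germ

variable {E : Type*} [NormedAddCommGroup E] [NormedSpace ℂ E] [FiniteDimensional ℂ E]
  {M : Type*} [TopologicalSpace M] [ChartedSpace E M] [IsManifold 𝓘(ℂ, E) ω M]

omit [FiniteDimensional ℂ E] [IsManifold 𝓘(ℂ, E) ω M] in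
theorem chartField_sub_sum {ι : Type*} [Fintype ι] (x₀ : M) (Y : ∀ x : M, TangentSpace 𝓘(ℂ, E) x)
    (c : ι → ℂ) (X : ι → ∀ x : M, TangentSpace 𝓘(ℂ, E) x) (z : E) :
    chartField x₀ (Y - ∑ i, c i • X i) z
      = chartField x₀ Y z - ∑ i, c i • chartField x₀ (X i) z := by
  unfold chartField
  rw [Pi.sub_apply, Finset.sum_apply]
  refine (map_sub (chartD x₀ ((chartAt E x₀).symm z)) _ _).trans ?_
  refine congrArg _ ?_
  refine (map_sum (chartD x₀ ((chartAt E x₀).symm z)) _ _).trans ?_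
  exact Finset.sum_congr rfl fun i _ => map_smul (chartD x₀ ((chartAt E x₀).symm z)) (c i) _

/-- Turns linear relations in the quotient of germs into relations between chart fields near one
point. -/
theorem Metric.mk_eq_sum_iff (g : Metric (E := E) M) {x₀ : M} {ι : Type*} [Fintype ι]
    (Y : g.killingNear x₀) (c : ι → ℂ) (X : ι → g.killingNear x₀) :
    (Submodule.Quotient.mk Y : g.KillingAlgebra x₀) = ∑ i, c i • Submodule.Quotient.mk (X i) ↔
      ∀ᶠ z in 𝓝 (chartAt E x₀ x₀),
        chartField x₀ Y z = ∑ i, c i • chartField x₀ (X i) z := by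
  have h : (∑ i, c i • Submodule.Quotient.mk (X i) : g.KillingAlgebra x₀)
      = Submodule.Quotient.mk (∑ i, c i • X i) := by
    simp only [← Submodule.mkQ_apply, map_sum, map_smul]
  rw [h, Submodule.Quotient.eq, Submodule.mem_comap]
  have h2 : (g.killingNear x₀).subtype (Y - ∑ i, c i • X i)
      = (Y : ∀ x : M, TangentSpace 𝓘(ℂ, E) x) - ∑ i, c i • (X i : ∀ x : M, TangentSpace 𝓘(ℂ, E) x) := by
    simp only [map_sub, map_sum, map_smul, Submodule.subtype_apply]
  rw [h2]
  refine chartField_eventually_eq_zero_iff.symm.trans (Filter.eventually_congr ?_)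
  refine Filter.Eventually.of_forall fun z => ?_
  rw [chartField_sub_sum, sub_eq_zero]

end Germ

end HolRiem

theorem mainTheorem7 {E : Type*} [NormedAddCommGroup E] [NormedSpace ℂ E]
    [FiniteDimensional ℂ E] (hE : Module.finrank ℂ E = 3)
    {M : Type*} [TopologicalSpace M] [ChartedSpace E M] [IsManifold 𝓘(ℂ, E) ω M]
    (g : HolRiem.Metric (E := E) M) (hg : g.LocallyHomogeneous) (x₀ : M) :
    Module.rank ℂ (g.KillingAlgebra x₀) ≠ 5 := by
  intro hr
  have : CompleteSpace E := FiniteDimensional.complete ℂ E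
  have hf : Module.finrank ℂ (g.KillingAlgebra x₀) = 5 := Module.finrank_eq_of_rank_eq hr
  have : Module.Finite ℂ (g.KillingAlgebra x₀) :=
    Module.finite_of_finrank_pos (by rw [hf]; norm_num)
  let b := Module.finBasisOfFinrankEq ℂ (g.KillingAlgebra x₀) hf
  choose X hX using fun i => Submodule.Quotient.mk_surjective _ (b i)
  have hs := mem_chart_source E x₀
  have ht := (chartAt E x₀).map_source hs
  have hsymm : Filter.Tendsto (chartAt E x₀).symm (𝓝 (chartAt E x₀ x₀)) (𝓝 x₀) := by
    have := (chartAt E x₀).continuousAt_symm ht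
    rwa [ContinuousAt, (chartAt E x₀).left_inv hs] at this
  have hnt := (chartAt E x₀).open_target.mem_nhds ht
  obtain ⟨X', hX', hnew⟩ := HolRiem.exists_sixth_flatKilling hE (g.contDiffAt_chartForm ht)
    (Filter.Eventually.of_forall (g.chartForm_symm x₀))
    (fun u => g.chartForm_nondegenerate ht)
    (X := fun i => HolRiem.chartField x₀ (X i))
    (fun i => by
      filter_upwards [hnt, hsymm.eventually (X i).2] with z hz h
      exact h.flatKillingAt hz)
    (fun c hc => by
      have h0 := (g.mk_eq_sum_iff 0 c X).2 (by
        filter_upwards [hc] with z hz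
        rw [hz]
        exact map_zero (HolRiem.chartD x₀ ((chartAt E x₀).symm z)))
      simp only [hX] at h0
      exact funext (Fintype.linearIndependent_iff.1 b.linearIndependent c h0.symm))
  have hK : HolRiem.ofChartField x₀ X' ∈ g.killingNear x₀ := by
    have := ((chartAt E x₀).continuousAt hs).eventually hX'
    filter_upwards [this, (chartAt E x₀).open_source.mem_nhds hs] with x h hx
    have := h.killingAt ((chartAt E x₀).map_source hx)
    rwa [(chartAt E x₀).left_inv hx] at this
  let v : g.KillingAlgebra x₀ := Submodule.Quotient.mk ⟨_, hK⟩
  have hv : v = ∑ i, b.repr v i • Submodule.Quotient.mk (X i) := by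
    simp only [hX]
    exact (b.sum_repr v).symm
  -- The coordinates of the new germ in the basis `b` would express `X'` through the five fields.
  refine hnew (b.repr v) ?_
  filter_upwards [hnt, (g.mk_eq_sum_iff ⟨_, hK⟩ (b.repr v) X).1 hv] with z hz h
  rwa [HolRiem.chartField_ofChartField hz] at h
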